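/- Let $P$ be a smooth manifold and let $(K,\eta)$ be a para-Hermitian structure on $P$: $K$ is a smooth endomorphism field of $TP$ with $K^2=1$ whose $\pm1$-eigenbundles $T_\pm$ have the same rank and are both involutive under the Lie bracket, and $\eta$ is a smooth non-degenerate symmetric bilinear form on $TP$ with $\eta(K\cdot,K\cdot)=-\eta$. Write $P_\pm=\frac12(1\pm K)$ and $x_+=P_+X$, and similarly for $Y,Z$. A (smooth) affine connection $\nabla$ with torsion $T$ is called $p$-adapted if for all sections $x_+,y_+,z_+$ of $T_+$ and $y_-,z_-$ of $T_-$: $\nabla_{x_+}\eta=0$; $\nabla_{x_+}y_-\in\Gamma(T_-)$; $\eta(T(x_+,y_+),z_-)=0$; $\eta(T(x_+,y_+),z_+)+\eta(\nabla_{z_+}x_+,y_+)=0$. It is called adapted if it satisfies these conditions and also the same conditions with $T_+$ and $T_-$ exchanged. The D-bracket of $(K,\eta)$ is defined with an adapted connection $\nabla$ by $$\eta([\![X,Y]\!]^D,Z)=\eta(\nabla_XY-\nabla_YX,Z)+\eta(\nabla_ZX,Y).$$ Let $B:T_+\to T_-$ be a smooth bundle map with $\eta(BX,Y)=-\eta(X,BY)$,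 extended by zero to $T_-$, and let $K_B=e^BKe^{-B}$ (with $e^{\pm B}=1\pm B$) be the corresponding B-transformation of $K$. Let $P^B_+=\frac12(1+K_B)$, and let $b$ denote both the two-form and the bivector determined by $b_+(X,Y)=b_-(\eta(X),\eta(Y))=\eta(BX,Y)$, so that $b_+\in\Gamma(\Lambda^2T_+^*)$ and $b_-\in\Gamma(\Lambda^2T_-)$. Let $\mathrm d_+$ be the Lie algebroid differential of $T_+$, let $[\ ,\ ]_-$ be the Schouten bracket of the Lie algebroid $T_-$, normalised so that $[\beta,\beta](\lambda,\mu,\nu)=\sum_{\mathrm{cycl}}(\nabla_{\beta(\lambda)}\beta)(\mu,\nu)$ for torsion-free $\nabla$ (equivalently $[X\wedge Y,X\wedge Y]=[X,Y]\wedge X\wedge Y$, where $(X\wedge Y)(\lambda,\mu)=\lambda(X)\mu(Y)-\lambda(Y)\mu(X)$ and triple wedge products are likewise evaluated by determinants; this is one half of the usual bracket), and let $((\Lambda^3\eta)t)(X,Y,Z)=t(\eta(X),\eta(Y),\eta(Z))$. Then adapted connections exist, and for the D-bracket defined with any adapted connection: 1. for all vector fields $X,Y,Z$ on $P$, $$\eta([\![P^B_+X,P^B_+Y]\!]^D,P^B_+Z)=\bigl(\mathrm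 d_+b+(\Lambda^3\eta)[b,b]_-\bigr)(x_+,y_+,z_+);$$ 2. $K_B$ is compatible with $K$ (i.e. both eigenbundles of $K_B$ are weakly integrable with respect to $K$: they are $\eta$-isotropic and the D-bracket of $K$ of any two sections is again a section) if and only if $$\mathrm d_+b+(\Lambda^3\eta)[b,b]_-=0 .$$ -/

import Mathlib

open scoped Manifold ContDiff Bundle

noncomputable section

namespace ParaHermitian

/-! All manifolds are smooth manifolds `P` without boundary, modelled on a finite-dimensional real
vector space `E`. -/

section Basic

variable (E : Type*) [NormedAddCommGroup E] [NormedSpace ℝ E]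
  (P : Type*) [TopologicalSpace P] [ChartedSpace E P]

/-- Vector fields on `P` (smoothness is a separate predicate). -/
abbrev VF := Π x : P, TangentSpace 𝓘(ℝ, E) x

/-- Fields of endomorphisms of the tangent bundle of `P`. -/
abbrev EndField := Π x : P, TangentSpace 𝓘(ℝ, E) x →L[ℝ] TangentSpace 𝓘(ℝ, E) x

/-- Fields of bilinear forms on the tangent bundle of `P`. -/
abbrev BilField := Π x : P, TangentSpace 𝓘(ℝ, E) x →L[ℝ] TangentSpace 𝓘(ℝ, E) x →L[ℝ] ℝ

/-- Fields of subspaces of the tangent spaces of `P`. -/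
abbrev Distribution := Π x : P, Submodule ℝ (TangentSpace 𝓘(ℝ, E) x)

/-- Affine connections on `P`: `∇ Y x v` is the derivative of `Y` at `x` along `v`. -/
abbrev Connection [IsManifold 𝓘(ℝ, E) ∞ P] :=
  CovariantDerivative 𝓘(ℝ, E) E (fun x : P ↦ TangentSpace 𝓘(ℝ, E) x)

end Basic

section Definitions

variable {E : Type*} [NormedAddCommGroup E] [NormedSpace ℝ E]
  {P : Type*} [TopologicalSpace P] [ChartedSpace E P]

/-! ### Smooth fields -/

/-- `X` is a smooth vector field on the set `U` (used for open `U`). -/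
def SmoothOn [IsManifold 𝓘(ℝ, E) ∞ P] (X : VF E P) (U : Set P) : Prop :=
  ContMDiffOn 𝓘(ℝ, E) (𝓘(ℝ, E).prod 𝓘(ℝ, E)) ∞
    (fun x ↦ (⟨x, X x⟩ : TangentBundle 𝓘(ℝ, E) P)) U

/-- `X` is a smooth vector field on `P`. -/
def Smooth [IsManifold 𝓘(ℝ, E) ∞ P] (X : VF E P) : Prop :=
  ContMDiff 𝓘(ℝ, E) (𝓘(ℝ, E).prod 𝓘(ℝ, E)) ∞
    (fun x ↦ (⟨x, X x⟩ : TangentBundle 𝓘(ℝ, E) P))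

/-- `X` is a smooth section of `L`, an element of `Γ(L)`. -/
def IsSection [IsManifold 𝓘(ℝ, E) ∞ P] (L : Distribution E P) (X : VF E P) : Prop :=
  Smooth X ∧ ∀ x, X x ∈ L x

/-- A smooth field of endomorphisms, i.e. a smooth section of `End(TP)`. -/
def SmoothEnd [IsManifold 𝓘(ℝ, E) ∞ P] (A : EndField E P) : Prop :=
  ContMDiff 𝓘(ℝ, E) (𝓘(ℝ, E).prod 𝓘(ℝ, E →L[ℝ] E)) ∞
    (fun x ↦ Bundle.TotalSpace.mk' (E →L[ℝ] E)
      (E := fun x : P ↦ TangentSpace 𝓘(ℝ, E) x →L[ℝ] TangentSpace 𝓘(ℝ, E) x) x (A x))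

/-- A smooth field of bilinear forms, i.e. a smooth section of `T*P ⊗ T*P`. -/
def SmoothBil [IsManifold 𝓘(ℝ, E) ∞ P] (g : BilField E P) : Prop :=
  ContMDiff 𝓘(ℝ, E) (𝓘(ℝ, E).prod 𝓘(ℝ, E →L[ℝ] E →L[ℝ] ℝ)) ∞
    (fun x ↦ Bundle.TotalSpace.mk' (E →L[ℝ] E →L[ℝ] ℝ)
      (E := fun x : P ↦ TangentSpace 𝓘(ℝ, E) x →L[ℝ] TangentSpace 𝓘(ℝ, E) x →L[ℝ] ℝ) x (g x))

/-- The derivative `X[f]` of a function along a vector field. -/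
def derivAlong (X : VF E P) (f : P → ℝ) (x : P) : ℝ := mvfderiv 𝓘(ℝ, E) f x (X x)

/-- The Lie bracket of vector fields. -/
def lie (X Y : VF E P) : VF E P := VectorField.mlieBracket 𝓘(ℝ, E) X Y

/-- Frobenius integrability, in the sense of involutivity under the Lie bracket. -/
def Involutive [IsManifold 𝓘(ℝ, E) ∞ P] (L : Distribution E P) : Prop :=
  ∀ X Y : VF E P, IsSection L X → IsSection L Y → ∀ x, lie X Y x ∈ L x

/-- The eigenbundle of the endomorphism field `K` for the eigenvalue `c`. -/
def eigenbundle (K : EndField E P) (c : ℝ) : Distribution E P :=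
  fun x ↦ Module.End.eigenspace ((K x : TangentSpace 𝓘(ℝ, E) x →ₗ[ℝ] TangentSpace 𝓘(ℝ, E) x)) c

/-! ### Lie algebroid differential and Schouten bracket of an involutive distribution

An involutive distribution `L` is a Lie algebroid: the bracket is the Lie bracket of vector fields,
the anchor is the inclusion into the tangent bundle. -/

/-- The Lie algebroid differential of a two-form `b`, evaluated on three sections of `L`. -/
def algebroidD (b : BilField E P) (X Y Z : VF E P) (x : P) : ℝ :=
  derivAlong X (fun y ↦ b y (Y y) (Z y)) x
    - derivAlong Y (fun y ↦ b y (X y) (Z y)) x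
    + derivAlong Z (fun y ↦ b y (X y) (Y y)) x
    - b x (lie X Y x) (Z x) + b x (lie X Z x) (Y x) - b x (lie Y Z x) (X x)

/-- Fields of bivectors, given by their values on pairs of covectors. -/
abbrev BivectorField (E : Type*) [NormedAddCommGroup E] [NormedSpace ℝ E]
    (P : Type*) [TopologicalSpace P] [ChartedSpace E P] :=
  Π x : P, (TangentSpace 𝓘(ℝ, E) x →L[ℝ] ℝ) → (TangentSpace 𝓘(ℝ, E) x →L[ℝ] ℝ) → ℝ

/-- Fields of trivectors, given by their values on triples of covectors. -/
abbrev TrivectorField (E : Type*) [NormedAddCommGroup E] [NormedSpace ℝ E]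
    (P : Type*) [TopologicalSpace P] [ChartedSpace E P] :=
  Π x : P, (TangentSpace 𝓘(ℝ, E) x →L[ℝ] ℝ) → (TangentSpace 𝓘(ℝ, E) x →L[ℝ] ℝ) →
    (TangentSpace 𝓘(ℝ, E) x →L[ℝ] ℝ) → ℝ

/-- The bivector field `X ∧ Y`. -/
def wedge₂ (X Y : VF E P) : BivectorField E P :=
  fun x α β ↦ α (X x) * β (Y x) - α (Y x) * β (X x)

/-- The trivector field `X ∧ Y ∧ Z`. -/
def wedge₃ (X Y Z : VF E P) : TrivectorField E P :=
  fun x α β γ ↦ Matrix.det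
    !![α (X x), α (Y x), α (Z x); β (X x), β (Y x), β (Z x); γ (X x), γ (Y x), γ (Z x)]

/-- The Schouten bracket of decomposable bivector fields,
`[X₁ ∧ X₂, Y₁ ∧ Y₂] = c ∑ (-1)^(i+j) [Xᵢ, Yⱼ] ∧ X_{3-i} ∧ Y_{3-j}`, with the normalisation
`c = 1/2`, for which `[X ∧ Y, X ∧ Y] = [X, Y] ∧ X ∧ Y`; equivalently `[β, β](λ, μ, ν)` is the cyclic
sum of `(∇_{β(λ)} β)(μ, ν)` for a torsion-free connection `∇`. -/
def schoutenDecomp (X₁ X₂ Y₁ Y₂ : VF E P) : TrivectorField E P :=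
  fun x α β γ ↦ (1 / 2 : ℝ) *
    (wedge₃ (lie X₁ Y₁) X₂ Y₂ x α β γ - wedge₃ (lie X₁ Y₂) X₂ Y₁ x α β γ
      - wedge₃ (lie X₂ Y₁) X₁ Y₂ x α β γ + wedge₃ (lie X₂ Y₂) X₁ Y₁ x α β γ)

/-- `T` is the Schouten bracket of the sections `p`, `q` of `Λ² L`: the bracket is local and
biadditive, and is given by `schoutenDecomp` on decomposable bivectors. Each point has a
neighbourhood on which `p` and `q` are finite sums of decomposable sections, so there is at most one
such `T`. -/
def IsSchoutenBracket [IsManifold 𝓘(ℝ, E) ∞ P] (L : Distribution E P) (p q : BivectorField E P)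
    (T : TrivectorField E P) : Prop :=
  ∀ U : Set P, IsOpen U → ∀ (m n : ℕ) (X X' : Fin m → VF E P) (Y Y' : Fin n → VF E P),
    (∀ i, SmoothOn (X i) U ∧ ∀ x ∈ U, X i x ∈ L x) →
    (∀ i, SmoothOn (X' i) U ∧ ∀ x ∈ U, X' i x ∈ L x) →
    (∀ j, SmoothOn (Y j) U ∧ ∀ x ∈ U, Y j x ∈ L x) →
    (∀ j, SmoothOn (Y' j) U ∧ ∀ x ∈ U, Y' j x ∈ L x) →
    (∀ x ∈ U, ∀ α β, p x α β = ∑ i, wedge₂ (X i) (X' i) x α β) →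
    (∀ x ∈ U, ∀ α β, q x α β = ∑ j, wedge₂ (Y j) (Y' j) x α β) →
    ∀ x ∈ U, ∀ α β γ, T x α β γ = ∑ i, ∑ j, schoutenDecomp (X i) (X' i) (Y j) (Y' j) x α β γ

open Classical in
/-- The Schouten bracket `[p, q]_L` of bivector fields `p, q ∈ Γ(Λ² L)`, for involutive `L`. -/
def schouten [IsManifold 𝓘(ℝ, E) ∞ P] (L : Distribution E P) (p q : BivectorField E P) :
    TrivectorField E P :=
  if h : ∃ T, IsSchoutenBracket L p q T then h.choose else fun _ _ _ _ ↦ 0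

end Definitions

/-! ### Almost para-Hermitian structures -/

/-- An almost para-Hermitian structure `(K, η)` on the manifold `P`. -/
structure AlmostParaHermitian (E : Type*) [NormedAddCommGroup E] [NormedSpace ℝ E]
    (P : Type*) [TopologicalSpace P] [ChartedSpace E P] [IsManifold 𝓘(ℝ, E) ∞ P] where
  /-- the almost para-complex structure -/
  K : EndField E P
  /-- the metric -/
  η : BilField E P
  smooth_K : SmoothEnd K
  smooth_η : SmoothBil η
  K_sq : ∀ x v, K x (K x v) = v
  rank_eq : ∀ x, Module.finrank ℝ (eigenbundle K 1 x) = Module.finrank ℝ (eigenbundle K (-1) x)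
  symm : ∀ x v w, η x v w = η x w v
  nondegenerate : ∀ x v, (∀ w, η x v w = 0) → v = 0
  compat : ∀ x v w, η x (K x v) (K x w) = - η x v w

namespace AlmostParaHermitian

variable {E : Type*} [NormedAddCommGroup E] [NormedSpace ℝ E]
  {P : Type*} [TopologicalSpace P] [ChartedSpace E P] [IsManifold 𝓘(ℝ, E) ∞ P]
  (S : AlmostParaHermitian E P)

/-- The `+1`-eigenbundle `T₊`. -/
def Tplus : Distribution E P := eigenbundle S.K 1

/-- The `-1`-eigenbundle `T₋`. -/
def Tminus : Distribution E P := eigenbundle S.K (-1)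

/-- `(K, η)` is para-Hermitian: both eigenbundles are integrable. -/
def IsParaHermitian : Prop := Involutive S.Tplus ∧ Involutive S.Tminus

section Sharp

variable [FiniteDimensional ℝ E]

theorem exists_sharp (x : P) (α : TangentSpace 𝓘(ℝ, E) x →L[ℝ] ℝ) : ∃ v, S.η x v = α := by
  have : FiniteDimensional ℝ (TangentSpace 𝓘(ℝ, E) x) := inferInstanceAs (FiniteDimensional ℝ E)
  let f : TangentSpace 𝓘(ℝ, E) x →ₗ[ℝ] Module.Dual ℝ (TangentSpace 𝓘(ℝ, E) x) :=
    (ContinuousLinearMap.coeLM ℝ).comp (S.η x).toLinearMap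
  have hf : Function.Injective f := by
    rw [injective_iff_map_eq_zero]
    intro v hv
    exact S.nondegenerate x v fun w ↦ LinearMap.congr_fun hv w
  have hs : Function.Surjective f :=
    (LinearMap.injective_iff_surjective_of_finrank_eq_finrank Subspace.dual_finrank_eq.symm).1 hf
  obtain ⟨v, hv⟩ := hs α.toLinearMap
  exact ⟨v, ContinuousLinearMap.ext fun w ↦ LinearMap.congr_fun hv w⟩

/-- The inverse `η⁻¹ : T*P → TP` of `v ↦ η(v, ·)`. -/
def sharp (x : P) (α : TangentSpace 𝓘(ℝ, E) x →L[ℝ] ℝ) : TangentSpace 𝓘(ℝ, E) x :=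
  (S.exists_sharp x α).choose

theorem η_sharp (x : P) (α : TangentSpace 𝓘(ℝ, E) x →L[ℝ] ℝ) : S.η x (S.sharp x α) = α :=
  (S.exists_sharp x α).choose_spec

end Sharp

/-! ### Adapted connections and the D-bracket -/

/-- The conditions for a connection to be p-adapted (for `L = T₊`, `L' = T₋`), respectively
n-adapted (for `L = T₋`, `L' = T₊`). The torsion is `T(X, Y) = ∇_X Y - ∇_Y X - [X, Y]`. -/
structure IsHalfAdapted (L L' : Distribution E P) (D : Connection E P) : Prop where
  metric : ∀ X Y Z : VF E P, IsSection L X → Smooth Y → Smooth Z → ∀ x,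
    derivAlong X (fun y ↦ S.η y (Y y) (Z y)) x = S.η x (D Y x (X x)) (Z x) + S.η x (Y x) (D Z x (X x))
  preserves : ∀ X Y : VF E P, IsSection L X → IsSection L' Y → ∀ x, D Y x (X x) ∈ L' x
  torsion_left : ∀ X Y Z : VF E P, IsSection L X → IsSection L Y → IsSection L' Z → ∀ x,
    S.η x (D Y x (X x) - D X x (Y x) - lie X Y x) (Z x) = 0
  torsion_right : ∀ X Y Z : VF E P, IsSection L X → IsSection L Y → IsSection L Z → ∀ x,
    S.η x (D Y x (X x) - D X x (Y x) - lie X Y x) (Z x) + S.η x (D X x (Z x)) (Y x) = 0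

/-- Adapted connections: smooth, p-adapted and n-adapted. -/
structure IsAdapted (D : Connection E P) : Prop where
  smooth : CovariantDerivative.ContMDiffCovariantDerivative D ∞
  p_adapted : S.IsHalfAdapted S.Tplus S.Tminus D
  n_adapted : S.IsHalfAdapted S.Tminus S.Tplus D

section Bracket

variable [FiniteDimensional ℝ E]

/-- The bracket associated to a connection; it is the D-bracket of `(K, η)` if the connection is
adapted. See `η_dBracket` for the defining equation. -/
def dBracket (D : Connection E P) (X Y : VF E P) : VF E P :=
  fun x ↦ D Y x (X x) - D X x (Y x) + S.sharp x ((S.η x (Y x)).comp (D X x))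

theorem η_dBracket (D : Connection E P) (X Y Z : VF E P) (x : P) :
    S.η x (S.dBracket D X Y x) (Z x) =
      S.η x (D Y x (X x) - D X x (Y x)) (Z x) + S.η x (D X x (Z x)) (Y x) := by
  simp [dBracket, η_sharp, S.symm x (Y x)]

/-- A distribution is weakly integrable if it is `η`-isotropic and involutive under the D-bracket. -/
def WeaklyIntegrable (D : Connection E P) (L : Distribution E P) : Prop :=
  (∀ x, ∀ v ∈ L x, ∀ w ∈ L x, S.η x v w = 0) ∧
    ∀ X Y : VF E P, IsSection L X → IsSection L Y → ∀ x, S.dBracket D X Y x ∈ L x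

/-- `K'` is compatible with `K`: both eigenbundles of `K'` are weakly integrable with respect to the
D-bracket of `K`. -/
def IsCompatible (D : Connection E P) (K' : EndField E P) : Prop :=
  S.WeaklyIntegrable D (eigenbundle K' 1) ∧ S.WeaklyIntegrable D (eigenbundle K' (-1))

end Bracket

/-! ### B-transformations -/

/-- `B` is a smooth skew map `T₊ → T₋`, extended by zero on `T₋` to an endomorphism of `TP`. -/
structure IsSkewMap (B : EndField E P) : Prop where
  smooth : SmoothEnd B
  maps_plus : ∀ x, ∀ v ∈ S.Tplus x, B x v ∈ S.Tminus x
  zero_minus : ∀ x, ∀ v ∈ S.Tminus x, B x v = 0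
  skew : ∀ x, ∀ v ∈ S.Tplus x, ∀ w ∈ S.Tplus x, S.η x (B x v) w = - S.η x v (B x w)

/-- The B-transformation `K_B = e^B K e^{-B}`, where `e^{±B} = 1 ± B` because `B² = 0`. -/
def bTransform (B : EndField E P) : EndField E P :=
  fun x ↦ ((ContinuousLinearMap.id ℝ _ + B x).comp (S.K x)).comp (ContinuousLinearMap.id ℝ _ - B x)

/-- The projection `½(1 + K')` associated to an endomorphism field `K'`. -/
def projPlus (K' : EndField E P) (X : VF E P) : VF E P :=
  fun x ↦ (1 / 2 : ℝ) • (X x + K' x (X x))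

/-- The two-form `b₊`, with `b₊(X, Y) = η(BX, Y)`. -/
def twoForm (B : EndField E P) : BilField E P := fun x ↦ (S.η x).comp (B x)

section MaurerCartan

variable [FiniteDimensional ℝ E]

/-- The bivector `b₋`, with `b₋(η(X), η(Y)) = η(BX, Y)`. -/
def bivector (B : EndField E P) : BivectorField E P :=
  fun x α β ↦ S.η x (B x (S.sharp x α)) (S.sharp x β)

/-- The three-form `d₊b + (Λ³η)[b, b]₋` on `T₊`, evaluated on sections of `T₊`. Here `d₊` is the Lie
algebroid differential of `T₊`, `[ , ]₋` is the Schouten bracket of `T₋`, and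
`(Λ³η)t (X, Y, Z) = t(η(X), η(Y), η(Z))`. -/
def maurerCartan (B : EndField E P) (X Y Z : VF E P) (x : P) : ℝ :=
  algebroidD (S.twoForm B) X Y Z x +
    schouten S.Tminus (S.bivector B) (S.bivector B) x (S.η x (X x)) (S.η x (Y x)) (S.η x (Z x))

end MaurerCartan

end AlmostParaHermitian

end ParaHermitian

end

/-! Since `K_B = K + 2B`, the `-1`-eigenbundle of `K_B` is `T₋` and the `+1`-eigenbundle is the
graph of `B`, consisting of the vectors `x + Bx` with `x` in `T₊`. So claim 1 asks for `η([[x + Bx,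
y + By]], z + Bz)`, which is expanded by degree in `B`. Degrees 0 and 3 vanish: the last torsion
condition says that the D-bracket of two sections of `T₊` pairs with a third to `η([x, y], z)`,
which is zero because `T₊` is involutive and isotropic; likewise for `T₋`. In degree 1 the
adaptedness conditions trade every covariant derivative for Lie brackets and derivatives of `b`,
which leaves `d₊b` (`dBracket_linear`). In degree 2 the same mechanism with the roles of `T₊` and
`T₋` exchanged gives an expression `schoutenForm` in Lie brackets of `Bx, By, Bz` and derivatives
along them (`dBracket_quadratic`).

It remains to recognise `schoutenForm` as `[b, b]₋`. For local decompositions of `b` into sums of `X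
∧ X'`, the derivatives of the coefficients cancel and the rest is the determinantal formula for the
Schouten bracket (`schoutenForm_eq`). This proves both that the bracket exists and what its value is
(`schouten_eq`).

For claim 2, the graph of `B` equals its own `η`-orthogonal (`mem_eigenbundle_of_η`). Hence it is
closed under the D-bracket exactly when the expression of claim 1 vanishes, while `T₋` is always
closed.

Adapted connections exist because their defining conditions are affine in the connection, so that
local solutions glue by a partition of unity (`exists_isPatching`). Along `T₊` the local solution is
the flat coordinate derivative projected to `T₊`, together with its `η`-dual on `T₋`; symmetrically
along `T₋`. Coordinate fields commute, so involutivity makes the torsion vanish on pairs of sections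
of the same eigenbundle (`isHalfAdapted`). -/

open scoped Topology

noncomputable section

namespace ParaHermitian

/-! ### Pointwise smoothness and differentiability of fields -/

section Smoothness

variable {E : Type*} [NormedAddCommGroup E] [NormedSpace ℝ E]
  {P : Type*} [TopologicalSpace P] [ChartedSpace E P] [IsManifold 𝓘(ℝ, E) ∞ P]

/-- `X` is smooth at `x`. -/
def SmoothAt (X : VF E P) (x : P) : Prop :=
  ContMDiffAt 𝓘(ℝ, E) (𝓘(ℝ, E).prod 𝓘(ℝ, E)) ∞
    (fun y ↦ (⟨y, X y⟩ : TangentBundle 𝓘(ℝ, E) P)) x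

/-- `X` is differentiable at `x`. -/
def DiffAt (X : VF E P) (x : P) : Prop :=
  MDifferentiableAt 𝓘(ℝ, E) (𝓘(ℝ, E).prod 𝓘(ℝ, E))
    (fun y ↦ (⟨y, X y⟩ : TangentBundle 𝓘(ℝ, E) P)) x

/-- The function `f` is smooth at `x`. -/
abbrev FunSmoothAt (f : P → ℝ) (x : P) : Prop := ContMDiffAt 𝓘(ℝ, E) 𝓘(ℝ) ∞ f x

/-- The function `f` is differentiable at `x`. -/
abbrev FunDiffAt (f : P → ℝ) (x : P) : Prop := MDifferentiableAt 𝓘(ℝ, E) 𝓘(ℝ) f x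

theorem Smooth.smoothAt {X : VF E P} (hX : Smooth X) (x : P) : SmoothAt X x := hX x

theorem SmoothOn.smoothAt {X : VF E P} {U : Set P} (hX : SmoothOn X U) (hU : IsOpen U) {x : P}
    (hx : x ∈ U) : SmoothAt X x := ContMDiffOn.contMDiffAt hX (hU.mem_nhds hx)

theorem SmoothAt.diffAt {X : VF E P} {x : P} (hX : SmoothAt X x) : DiffAt X x :=
  ContMDiffAt.mdifferentiableAt hX (by simp)

theorem SmoothAt.add {X Y : VF E P} {x : P} (hX : SmoothAt X x) (hY : SmoothAt Y x) :
    SmoothAt (X + Y) x := ContMDiffAt.add_section hX hY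

theorem SmoothAt.smul {f : P → ℝ} {X : VF E P} {x : P}
    (hf : FunSmoothAt (E := E) f x) (hX : SmoothAt X x) :
    SmoothAt (fun y ↦ f y • X y) x := ContMDiffAt.smul_section hf hX

theorem SmoothAt.sum {ι : Type*} {s : Finset ι} {X : ι → VF E P} {x : P}
    (hX : ∀ i ∈ s, SmoothAt (X i) x) : SmoothAt (fun y ↦ ∑ i ∈ s, X i y) x :=
  ContMDiffAt.sum_section hX

theorem DiffAt.smul {f : P → ℝ} {X : VF E P} {x : P}
    (hf : FunDiffAt (E := E) f x) (hX : DiffAt X x) :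
    DiffAt (fun y ↦ f y • X y) x := MDifferentiableAt.smul_section hf hX

theorem DiffAt.sum {ι : Type*} {s : Finset ι} {X : ι → VF E P} {x : P}
    (hX : ∀ i ∈ s, DiffAt (X i) x) : DiffAt (fun y ↦ ∑ i ∈ s, X i y) x :=
  MDifferentiableAt.sum_section hX

theorem SmoothEnd.smoothAt {A : EndField E P} (hA : SmoothEnd A) {X : VF E P} {x : P}
    (hX : SmoothAt X x) : SmoothAt (fun y ↦ A y (X y)) x :=
  ContMDiffAt.clm_bundle_apply (hA x) hX

theorem SmoothEnd.diffAt {A : EndField E P} (hA : SmoothEnd A) {X : VF E P} {x : P}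
    (hX : DiffAt X x) : DiffAt (fun y ↦ A y (X y)) x :=
  MDifferentiableAt.clm_bundle_apply ((hA x).mdifferentiableAt (by simp)) hX

theorem SmoothEnd.smooth {A : EndField E P} (hA : SmoothEnd A) {X : VF E P}
    (hX : Smooth X) : Smooth (fun y ↦ A y (X y)) := fun x ↦ hA.smoothAt (hX x)

theorem SmoothBil.funSmoothAt {g : BilField E P} (hg : SmoothBil g) {X Y : VF E P} {x : P}
    (hX : SmoothAt X x) (hY : SmoothAt Y x) : FunSmoothAt (E := E) (fun y ↦ g y (X y) (Y y)) x := by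
  have : ContMDiffAt 𝓘(ℝ, E) (𝓘(ℝ, E).prod 𝓘(ℝ)) ∞
      (fun y ↦ Bundle.TotalSpace.mk' ℝ (E := Bundle.Trivial P ℝ) y (g y (X y) (Y y))) x :=
    ContMDiffAt.clm_bundle_apply₂ (hg x) hX hY
  rw [Bundle.contMDiffAt_section] at this
  exact this

theorem SmoothBil.funDiffAt {g : BilField E P} (hg : SmoothBil g) {X Y : VF E P} {x : P}
    (hX : DiffAt X x) (hY : DiffAt Y x) : FunDiffAt (E := E) (fun y ↦ g y (X y) (Y y)) x := by
  have : MDifferentiableAt 𝓘(ℝ, E) (𝓘(ℝ, E).prod 𝓘(ℝ))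
      (fun y ↦ Bundle.TotalSpace.mk' ℝ (E := Bundle.Trivial P ℝ) y (g y (X y) (Y y))) x :=
    MDifferentiableAt.clm_bundle_apply₂ ((hg x).mdifferentiableAt (by simp)) hX hY
  simpa [mdifferentiableAt_section] using! this

theorem SmoothAt.derivAlong {f : P → ℝ} {X : VF E P} {x : P} (hX : SmoothAt X x)
    (hf : FunSmoothAt (E := E) f x) : FunSmoothAt (E := E) (derivAlong X f) x := by
  have h1 := hf.mfderiv_const (m := ∞) (by simp)
  have h2 : ContMDiffAt 𝓘(ℝ, E) (𝓘(ℝ).prod 𝓘(ℝ)) ∞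
      (fun y ↦ (⟨f y, mfderiv 𝓘(ℝ, E) 𝓘(ℝ) f y (X y)⟩ : TangentBundle 𝓘(ℝ) ℝ)) x :=
    ContMDiffAt.clm_apply_of_inCoordinates h1 hX hf
  exact (contMDiff_snd_tangentBundle_modelSpace ℝ 𝓘(ℝ)).contMDiffAt.comp x h2

/-- Prescribing the value at one point is a fibrewise convex condition that is locally solvable, so
a partition of unity glues local solutions. `HEq` imposes the condition only over `x` without
transporting between fibres. -/
theorem exists_smooth_eq [FiniteDimensional ℝ E] [T2Space P] [SigmaCompactSpace P]
    (x : P) (v : TangentSpace 𝓘(ℝ, E) x) : ∃ X : VF E P, Smooth X ∧ X x = v := by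
  classical
  obtain ⟨s, hs⟩ := exists_contMDiffSection_forall_mem_convex_of_local (n := (⊤ : ℕ∞)) 𝓘(ℝ, E)
    (F_fiber := E) (fun y : P ↦ TangentSpace 𝓘(ℝ, E) y)
    (fun y ↦ {w | y = x → HEq w v}) (fun y ↦ by
      by_cases h : y = x
      · subst h
        simp
      · simpa [h] using convex_univ) (fun y ↦ by
      by_cases h : y = x
      · subst h
        obtain ⟨U, hU, hs⟩ := FiberBundle.exists_contMDiffOn_extend
          (k := ((⊤ : ℕ∞) : WithTop ℕ∞)) (I := 𝓘(ℝ, E)) (F := E)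
          (V := fun y : P ↦ TangentSpace 𝓘(ℝ, E) y) v
        refine ⟨U, hU, _, hs, ?_⟩
        rintro z - rfl
        simp
      · exact ⟨{x}ᶜ, isOpen_compl_singleton.mem_nhds h, 0,
          (Bundle.contMDiff_zeroSection ℝ _).contMDiffOn, fun z hz hz' ↦ (hz hz').elim⟩)
  exact ⟨s, s.contMDiff, eq_of_heq (hs x rfl)⟩

end Smoothness

/-! ### Calculus of directional derivatives and Lie brackets -/

section Lie

variable {E : Type*} [NormedAddCommGroup E] [NormedSpace ℝ E]
  {P : Type*} [TopologicalSpace P] [ChartedSpace E P]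

theorem lie_congr {X X' Y Y' : VF E P} {x : P} (hX : ∀ᶠ y in 𝓝 x, X y = X' y)
    (hY : ∀ᶠ y in 𝓝 x, Y y = Y' y) : lie X Y x = lie X' Y' x :=
  Filter.EventuallyEq.mlieBracket_vectorField_eq hX hY

theorem lie_swap (X Y : VF E P) (x : P) : lie X Y x = - lie Y X x :=
  VectorField.mlieBracket_swap_apply

theorem derivAlong_mul {f g : P → ℝ} {X : VF E P} {x : P} (hf : FunDiffAt (E := E) f x)
    (hg : FunDiffAt (E := E) g x) : derivAlong X (fun y ↦ f y * g y) x =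
      derivAlong X f x * g x + f x * derivAlong X g x := by
  simp [derivAlong, mvfderiv_fun_mul hf hg]
  ring

theorem FunDiffAt.sum {ι : Type*} {s : Finset ι} {f : ι → P → ℝ} {x : P}
    (hf : ∀ i ∈ s, FunDiffAt (E := E) (f i) x) :
    FunDiffAt (E := E) (fun y ↦ ∑ i ∈ s, f i y) x := by
  classical
  induction s using Finset.induction_on with
  | empty => simpa using mdifferentiableAt_const
  | insert i s hi h =>
    simp only [Finset.mem_insert, forall_eq_or_imp] at hf
    simp only [Finset.sum_insert hi]
    exact MDifferentiableAt.add hf.1 (h hf.2)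

theorem derivAlong_sum {ι : Type*} {s : Finset ι} {f : ι → P → ℝ} {X : VF E P} {x : P}
    (hf : ∀ i ∈ s, FunDiffAt (E := E) (f i) x) : derivAlong X (fun y ↦ ∑ i ∈ s, f i y) x =
      ∑ i ∈ s, derivAlong X (f i) x := by
  classical
  induction s using Finset.induction_on with
  | empty => simp [derivAlong, mvfderiv_const]
  | insert i s hi h =>
    simp only [Finset.mem_insert, forall_eq_or_imp] at hf
    have h2 : FunDiffAt (E := E) (fun y ↦ ∑ i ∈ s, f i y) x := FunDiffAt.sum hf.2
    simp only [Finset.sum_insert hi, ← h hf.2]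
    simp [derivAlong, mvfderiv_fun_add hf.1 h2]

theorem derivAlong_congr {f g : P → ℝ} {X : VF E P} {x : P} (h : ∀ᶠ y in 𝓝 x, f y = g y) :
    derivAlong X f x = derivAlong X g x := by
  have : f =ᶠ[𝓝 x] g := h
  simp only [derivAlong, mvfderiv, this.mfderiv_eq]
  rfl

variable [IsManifold 𝓘(ℝ, E) ∞ P] [FiniteDimensional ℝ E]

theorem lie_smul_right {f : P → ℝ} {X Y : VF E P} {x : P} (hf : FunDiffAt (E := E) f x)
    (hY : DiffAt Y x) :
    lie X (fun y ↦ f y • Y y) x = derivAlong X f x • Y x + f x • lie X Y x :=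
  VectorField.mlieBracket_smul_right hf hY

theorem lie_smul_left {f : P → ℝ} {X Y : VF E P} {x : P} (hf : FunDiffAt (E := E) f x)
    (hX : DiffAt X x) :
    lie (fun y ↦ f y • X y) Y x = - derivAlong Y f x • X x + f x • lie X Y x :=
  VectorField.mlieBracket_smul_left hf hX

theorem lie_sum_right {ι : Type*} {s : Finset ι} {X : VF E P} {Y : ι → VF E P} {x : P}
    (hY : ∀ i ∈ s, DiffAt (Y i) x) : lie X (fun y ↦ ∑ i ∈ s, Y i y) x = ∑ i ∈ s, lie X (Y i) x := by
  classical
  induction s using Finset.induction_on with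
  | empty =>
    have : (fun y ↦ ∑ i ∈ (∅ : Finset ι), Y i y) = (0 : VF E P) := by ext; simp
    rw [this]
    simp [lie]
  | insert i s hi h =>
    simp only [Finset.mem_insert, forall_eq_or_imp] at hY
    simp only [Finset.sum_insert hi, ← h hY.2]
    exact VectorField.mlieBracket_add_right hY.1 (DiffAt.sum hY.2)

theorem lie_sum_left {ι : Type*} {s : Finset ι} {X : ι → VF E P} {Y : VF E P} {x : P}
    (hX : ∀ i ∈ s, DiffAt (X i) x) : lie (fun y ↦ ∑ i ∈ s, X i y) Y x = ∑ i ∈ s, lie (X i) Y x := by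
  rw [lie_swap, lie_sum_right hX, ← Finset.sum_neg_distrib]
  exact Finset.sum_congr rfl fun i _ ↦ (lie_swap _ _ _).symm

end Lie

namespace AlmostParaHermitian

variable {E : Type*} [NormedAddCommGroup E] [NormedSpace ℝ E]
  {P : Type*} [TopologicalSpace P] [ChartedSpace E P] [IsManifold 𝓘(ℝ, E) ∞ P]
  (S : AlmostParaHermitian E P)

/-! ### The projections onto the eigenbundles -/

/-- The projection `P₊ = ½(1 + K)`. -/
def posProj : EndField E P := fun x ↦ (1 / 2 : ℝ) • (ContinuousLinearMap.id ℝ _ + S.K x)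

/-- The projection `P₋ = ½(1 - K)`. -/
def negProj : EndField E P := fun x ↦ (1 / 2 : ℝ) • (ContinuousLinearMap.id ℝ _ - S.K x)

variable {S} {x : P} {v w : TangentSpace 𝓘(ℝ, E) x}

theorem posProj_apply : S.posProj x v = (1 / 2 : ℝ) • (v + S.K x v) := rfl

theorem negProj_apply : S.negProj x v = (1 / 2 : ℝ) • (v - S.K x v) := rfl

theorem mem_Tplus : v ∈ S.Tplus x ↔ S.K x v = v := by
  simp [Tplus, eigenbundle]

theorem mem_Tminus : v ∈ S.Tminus x ↔ S.K x v = -v := by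
  simp [Tminus, eigenbundle]

variable (S v) in
theorem posProj_mem : S.posProj x v ∈ S.Tplus x := by
  rw [mem_Tplus, posProj_apply, map_smul, map_add, S.K_sq, add_comm]

variable (S v) in
theorem negProj_mem : S.negProj x v ∈ S.Tminus x := by
  rw [mem_Tminus, negProj_apply, map_smul, map_sub, S.K_sq, ← smul_neg, neg_sub]

variable (S v) in
theorem posProj_add_negProj : S.posProj x v + S.negProj x v = v := by
  rw [posProj_apply, negProj_apply]
  module

theorem posProj_of_mem (hv : v ∈ S.Tplus x) : S.posProj x v = v := by
  rw [posProj_apply, mem_Tplus.1 hv]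
  module

theorem negProj_of_mem (hv : v ∈ S.Tminus x) : S.negProj x v = v := by
  rw [negProj_apply, mem_Tminus.1 hv]
  module

theorem posProj_of_mem_Tminus (hv : v ∈ S.Tminus x) : S.posProj x v = 0 := by
  rw [posProj_apply, mem_Tminus.1 hv]
  module

theorem negProj_of_mem_Tplus (hv : v ∈ S.Tplus x) : S.negProj x v = 0 := by
  rw [negProj_apply, mem_Tplus.1 hv]
  module

theorem η_Tplus (hv : v ∈ S.Tplus x) (hw : w ∈ S.Tplus x) : S.η x v w = 0 := by
  have := S.compat x v w
  rw [mem_Tplus.1 hv, mem_Tplus.1 hw] at this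
  linarith

theorem η_Tminus (hv : v ∈ S.Tminus x) (hw : w ∈ S.Tminus x) : S.η x v w = 0 := by
  have := S.compat x v w
  rw [mem_Tminus.1 hv, mem_Tminus.1 hw] at this
  simp only [map_neg, neg_neg, _root_.neg_apply] at this
  linarith

theorem η_eq_add : S.η x v w =
    S.η x (S.posProj x v) (S.negProj x w) + S.η x (S.negProj x v) (S.posProj x w) := by
  conv_lhs => rw [← posProj_add_negProj S v, ← posProj_add_negProj S w]
  simp only [map_add, _root_.add_apply, η_Tplus (posProj_mem S v) (posProj_mem S w),
    η_Tminus (negProj_mem S v) (negProj_mem S w)]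
  ring

/-- Both eigenbundles are isotropic, so `P₊` and `P₋` are `η`-adjoint to each other. -/
theorem η_posProj_left : S.η x (S.posProj x v) w = S.η x v (S.negProj x w) := by
  rw [η_eq_add, η_eq_add (v := v), posProj_of_mem (posProj_mem S v),
    negProj_of_mem_Tplus (posProj_mem S v), posProj_of_mem_Tminus (negProj_mem S w),
    negProj_of_mem (negProj_mem S w)]
  simp

theorem η_negProj_left : S.η x (S.negProj x v) w = S.η x v (S.posProj x w) := by
  rw [S.symm, ← η_posProj_left, S.symm]

theorem mem_Tminus_of_η (h : ∀ w ∈ S.Tminus x, S.η x v w = 0) : v ∈ S.Tminus x := by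
  have : S.posProj x v = 0 := S.nondegenerate x _ fun w ↦ by
    rw [η_posProj_left]
    exact h _ (negProj_mem S w)
  have h2 := posProj_add_negProj S v
  rw [this, zero_add] at h2
  exact h2 ▸ negProj_mem S v

theorem smoothAt_posProj {X : VF E P} (hX : SmoothAt X x) :
    SmoothAt (fun y ↦ S.posProj y (X y)) x :=
  SmoothAt.smul (contMDiffAt_const (c := (1 / 2 : ℝ))) (hX.add (S.smooth_K.smoothAt hX))

theorem smoothAt_negProj {X : VF E P} (hX : SmoothAt X x) :
    SmoothAt (fun y ↦ S.negProj y (X y)) x :=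
  SmoothAt.smul (contMDiffAt_const (c := (1 / 2 : ℝ)))
    (ContMDiffAt.sub_section hX (S.smooth_K.smoothAt hX))

theorem isSection_posProj {X : VF E P} (hX : Smooth X) :
    IsSection S.Tplus (fun y ↦ S.posProj y (X y)) :=
  ⟨fun y ↦ smoothAt_posProj (hX y), fun y ↦ posProj_mem S (X y)⟩

theorem isSection_negProj {X : VF E P} (hX : Smooth X) :
    IsSection S.Tminus (fun y ↦ S.negProj y (X y)) :=
  ⟨fun y ↦ smoothAt_negProj (hX y), fun y ↦ negProj_mem S (X y)⟩

variable (S) in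
theorem projPlus_K (X : VF E P) : projPlus S.K X = fun y ↦ S.posProj y (X y) := rfl

theorem exists_isSection_Tminus [FiniteDimensional ℝ E] [T2Space P] [SigmaCompactSpace P]
    (hv : v ∈ S.Tminus x) : ∃ X, IsSection S.Tminus X ∧ X x = v := by
  obtain ⟨X, hX, rfl⟩ := exists_smooth_eq x v
  exact ⟨_, isSection_negProj hX, negProj_of_mem hv⟩

/-! ### B-transformations -/

namespace IsSkewMap

variable {B : EndField E P} (hB : S.IsSkewMap B)
include hB

theorem apply_eq (v : TangentSpace 𝓘(ℝ, E) x) : B x v = B x (S.posProj x v) := by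
  conv_lhs => rw [← posProj_add_negProj S v]
  rw [map_add, hB.zero_minus x _ (negProj_mem S v), add_zero]

theorem mem (v : TangentSpace 𝓘(ℝ, E) x) : B x v ∈ S.Tminus x := by
  rw [hB.apply_eq]
  exact hB.maps_plus x _ (posProj_mem S v)

theorem apply_apply (v : TangentSpace 𝓘(ℝ, E) x) : B x (B x v) = 0 :=
  hB.zero_minus x _ (hB.mem v)

/-- Skewness is assumed on `T₊` only. It extends to all vectors because `B` factors through `P₊` and
`Bv`, lying in the isotropic `T₋`, sees only the `T₊`-part of `w`. -/
theorem η_apply (v w : TangentSpace 𝓘(ℝ, E) x) : S.η x (B x v) w = - S.η x (B x w) v := by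
  conv_lhs => rw [← negProj_of_mem (hB.mem v), η_negProj_left, hB.apply_eq v,
    hB.skew x _ (posProj_mem S v) _ (posProj_mem S w), S.symm, ← hB.apply_eq w, ← η_negProj_left,
    negProj_of_mem (hB.mem w)]

/-- Expand `(1 + B)K(1 - B)` with `KB = -B`, `BK = B` and `B² = 0`. -/
theorem bTransform_apply (v : TangentSpace 𝓘(ℝ, E) x) :
    S.bTransform B x v = S.K x v + (2 : ℝ) • B x v := by
  have h1 : S.K x (B x v) = - B x v := mem_Tminus.1 (hB.mem v)
  have h2 : B x (S.K x v) = B x v := by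
    rw [hB.apply_eq, hB.apply_eq v, posProj_apply, posProj_apply, S.K_sq, add_comm]
  simp only [bTransform, ContinuousLinearMap.comp_apply, _root_.sub_apply,
    _root_.add_apply, ContinuousLinearMap.id_apply, map_sub, h1, h2, map_neg,
    hB.apply_apply]
  module

theorem projPlus_bTransform (X : VF E P) :
    projPlus (S.bTransform B) X = (fun y ↦ S.posProj y (X y)) + fun y ↦ B y (S.posProj y (X y)) := by
  ext y
  simp only [projPlus, hB.bTransform_apply, Pi.add_apply]
  rw [← hB.apply_eq, posProj_apply]
  module

theorem mem_eigenbundle_one : v ∈ eigenbundle (S.bTransform B) 1 x ↔ S.negProj x v = B x v := by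
  simp only [eigenbundle, Module.End.mem_eigenspace_iff, ContinuousLinearMap.coe_coe,
    hB.bTransform_apply, negProj_apply, one_smul]
  constructor
  · intro h
    nth_rw 1 [← h]
    module
  · intro h
    rw [← h]
    module

theorem mem_eigenbundle_neg_one : v ∈ eigenbundle (S.bTransform B) (-1) x ↔ v ∈ S.Tminus x := by
  simp only [eigenbundle, Module.End.mem_eigenspace_iff, ContinuousLinearMap.coe_coe,
    hB.bTransform_apply]
  constructor
  · intro h
    have h1 : S.posProj x v = - B x v := by
      rw [posProj_apply, eq_sub_of_add_eq h]
      module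
    have h2 : S.posProj x v = 0 := by
      rw [← posProj_of_mem (posProj_mem S v), h1, map_neg, posProj_of_mem_Tminus (hB.mem v), neg_zero]
    have h3 := posProj_add_negProj S v
    rw [h2, zero_add] at h3
    exact h3 ▸ negProj_mem S v
  · intro h
    rw [hB.zero_minus x v h, mem_Tminus.1 h]
    module

theorem add_mem_eigenbundle (hv : v ∈ S.Tplus x) :
    v + B x v ∈ eigenbundle (S.bTransform B) 1 x := by
  rw [hB.mem_eigenbundle_one, map_add, map_add, hB.apply_apply, negProj_of_mem_Tplus hv,
    negProj_of_mem (hB.mem v), zero_add, add_zero]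

theorem eq_of_mem_eigenbundle (hv : v ∈ eigenbundle (S.bTransform B) 1 x) :
    S.posProj x v + B x (S.posProj x v) = v := by
  rw [← hB.apply_eq, ← hB.mem_eigenbundle_one.1 hv, posProj_add_negProj]

theorem η_eigenbundle (hv : v ∈ eigenbundle (S.bTransform B) 1 x)
    (hw : w ∈ eigenbundle (S.bTransform B) 1 x) : S.η x v w = 0 := by
  have h1 : S.η x (S.posProj x v) (B x w) = - S.η x (B x v) w := by
    rw [S.symm, hB.η_apply, ← hB.apply_eq]
  have h2 : S.η x (B x v) (S.posProj x w) = S.η x (B x v) w := by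
    rw [← η_negProj_left, negProj_of_mem (hB.mem v)]
  rw [η_eq_add, hB.mem_eigenbundle_one.1 hv, hB.mem_eigenbundle_one.1 hw, h1, h2, neg_add_cancel]

/-- The graph of `B` is maximally isotropic: pairing `v` with the graph vector over `P₊w` gives
`η(P₋v - Bv, w)`, for arbitrary `w`. -/
theorem mem_eigenbundle_of_η (h : ∀ w ∈ eigenbundle (S.bTransform B) 1 x, S.η x v w = 0) :
    v ∈ eigenbundle (S.bTransform B) 1 x := by
  rw [hB.mem_eigenbundle_one, ← sub_eq_zero]
  refine S.nondegenerate x _ fun w ↦ ?_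
  have h1 := h _ (hB.add_mem_eigenbundle (posProj_mem S w))
  rw [map_add, ← η_negProj_left, ← hB.apply_eq, S.symm _ _ (B x w), hB.η_apply] at h1
  rw [map_sub, _root_.sub_apply]
  linarith

end IsSkewMap

end AlmostParaHermitian

/-! ### The D-bracket of graph sections, by degree in `B` -/

namespace AlmostParaHermitian

variable {E : Type*} [NormedAddCommGroup E] [NormedSpace ℝ E]
  {P : Type*} [TopologicalSpace P] [ChartedSpace E P] [IsManifold 𝓘(ℝ, E) ∞ P]
  {S : AlmostParaHermitian E P} {B : EndField E P}

theorem IsSkewMap.isSection (hB : S.IsSkewMap B) {X : VF E P} (hX : Smooth X) :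
    IsSection S.Tminus (fun y ↦ B y (X y)) :=
  ⟨hB.smooth.smooth hX, fun y ↦ hB.mem (X y)⟩

variable (S B) in
/-- The three-form `(Λ³η)[b, b]₋` on `T₊` written in terms of derivatives and Lie brackets. -/
def schoutenForm (X Y Z : VF E P) (x : P) : ℝ :=
  S.η x (X x) (lie (fun y ↦ B y (Y y)) (fun y ↦ B y (Z y)) x)
    + S.η x (Y x) (lie (fun y ↦ B y (Z y)) (fun y ↦ B y (X y)) x)
    + S.η x (Z x) (lie (fun y ↦ B y (X y)) (fun y ↦ B y (Y y)) x)
    - derivAlong (fun y ↦ B y (X y)) (fun y ↦ S.η y (B y (Y y)) (Z y)) x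
    - derivAlong (fun y ↦ B y (Y y)) (fun y ↦ S.η y (B y (Z y)) (X y)) x
    - derivAlong (fun y ↦ B y (Z y)) (fun y ↦ S.η y (B y (X y)) (Y y)) x

theorem derivAlong_skew (hB : S.IsSkewMap B) (X Y Z : VF E P) (x : P) :
    derivAlong X (fun y ↦ S.η y (B y (Y y)) (Z y)) x =
      - derivAlong X (fun y ↦ S.η y (B y (Z y)) (Y y)) x := by
  have : (fun y ↦ S.η y (B y (Y y)) (Z y)) = fun y ↦ - S.η y (B y (Z y)) (Y y) := by
    ext y
    rw [hB.η_apply]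
  simp [this, derivAlong, mvfderiv_fun_neg]

section DBracket

variable {D : Connection E P} {x : P} {X Y Z : VF E P}

theorem IsHalfAdapted.η_deriv_Tplus (hD : S.IsHalfAdapted S.Tminus S.Tplus D)
    (hX : IsSection S.Tminus X) (hY : IsSection S.Tplus Y) (hZ : IsSection S.Tplus Z) :
    S.η x (D Y x (X x)) (Z x) = 0 :=
  η_Tplus (hD.preserves X Y hX hY x) (hZ.2 x)

theorem IsHalfAdapted.η_deriv_Tminus (hD : S.IsHalfAdapted S.Tplus S.Tminus D)
    (hX : IsSection S.Tplus X) (hY : IsSection S.Tminus Y) (hZ : IsSection S.Tminus Z) :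
    S.η x (D Y x (X x)) (Z x) = 0 :=
  η_Tminus (hD.preserves X Y hX hY x) (hZ.2 x)

variable [FiniteDimensional ℝ E]

/-- The left side of `torsion_right` is the defining expression of the D-bracket minus `η([X, Y],
Z)`, and the latter vanishes by involutivity and isotropy. -/
theorem IsAdapted.dBracket_Tplus (hS : S.IsParaHermitian) (hD : S.IsAdapted D)
    (hX : IsSection S.Tplus X) (hY : IsSection S.Tplus Y) (hZ : IsSection S.Tplus Z) :
    S.η x (S.dBracket D X Y x) (Z x) = 0 := by
  have h1 := hD.p_adapted.torsion_right X Y Z hX hY hZ x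
  have h2 : S.η x (lie X Y x) (Z x) = 0 := η_Tplus (hS.1 X Y hX hY x) (hZ.2 x)
  rw [map_sub, _root_.sub_apply, h2, sub_zero] at h1
  rw [η_dBracket, h1]

theorem IsAdapted.dBracket_Tminus (hS : S.IsParaHermitian) (hD : S.IsAdapted D)
    (hX : IsSection S.Tminus X) (hY : IsSection S.Tminus Y) (hZ : IsSection S.Tminus Z) :
    S.η x (S.dBracket D X Y x) (Z x) = 0 := by
  have h1 := hD.n_adapted.torsion_right X Y Z hX hY hZ x
  have h2 : S.η x (lie X Y x) (Z x) = 0 := η_Tminus (hS.2 X Y hX hY x) (hZ.2 x)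
  rw [map_sub, _root_.sub_apply, h2, sub_zero] at h1
  rw [η_dBracket, h1]

/-- The part of the D-bracket of `x + Bx` and `y + By` that is linear in `B`. -/
theorem IsAdapted.dBracket_linear (hD : S.IsAdapted D) (hB : S.IsSkewMap B)
    (hX : IsSection S.Tplus X) (hY : IsSection S.Tplus Y) (hZ : IsSection S.Tplus Z) :
    S.η x (S.dBracket D X Y x) (B x (Z x))
      + S.η x (S.dBracket D X (fun y ↦ B y (Y y)) x) (Z x)
      + S.η x (S.dBracket D (fun y ↦ B y (X y)) Y x) (Z x) =
    algebroidD (S.twoForm B) X Y Z x := by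
  have hBX := hB.isSection hX.1
  have hBY := hB.isSection hY.1
  have hBZ := hB.isSection hZ.1
  have e1 := S.η_dBracket D X Y (fun y ↦ B y (Z y)) x
  have e2 := S.η_dBracket D X (fun y ↦ B y (Y y)) Z x
  have e3 := S.η_dBracket D (fun y ↦ B y (X y)) Y Z x
  -- The `t`'s turn differences of derivatives along `T₊` into Lie brackets, the `n`'s kill
  -- derivatives of sections of `T₊` along `T₋`, and the `m`'s move derivatives off `BX` and `BY`.
  -- The claim is then a linear combination of these identities and the skewness of `B`.
  have t1 := hD.p_adapted.torsion_left X Y _ hX hY hBZ x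
  have t2 := hD.p_adapted.torsion_left X Z _ hX hZ hBY x
  have t3 := hD.p_adapted.torsion_left Y Z _ hY hZ hBX x
  have n1 := hD.n_adapted.η_deriv_Tplus (x := x) hBZ hX hY
  have n2 := hD.n_adapted.η_deriv_Tplus (x := x) hBY hX hZ
  have n3 := hD.n_adapted.η_deriv_Tplus (x := x) hBX hY hZ
  have m1 := hD.p_adapted.metric X _ Z hX hBY.1 hZ.1 x
  have m2 := hD.p_adapted.metric Y _ Z hY hBX.1 hZ.1 x
  have m3 := hD.p_adapted.metric Z _ Y hZ hBX.1 hY.1 x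
  have l1 := hB.η_apply (lie X Y x) (Z x)
  have l2 := hB.η_apply (lie X Z x) (Y x)
  have l3 := hB.η_apply (lie Y Z x) (X x)
  rw [S.symm x (B x (Y x))] at m1 l2
  rw [S.symm x (B x (X x))] at m2 m3 l3
  rw [S.symm x (B x (Z x))] at l1
  simp only [map_sub, _root_.sub_apply] at e1 e2 e3 t1 t2 t3
  simp only [algebroidD, twoForm, ContinuousLinearMap.comp_apply]
  linarith

/-- The part of the D-bracket of `x + Bx` and `y + By` that is quadratic in `B`. -/
theorem IsAdapted.dBracket_quadratic (hD : S.IsAdapted D) (hB : S.IsSkewMap B)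
    (hX : IsSection S.Tplus X) (hY : IsSection S.Tplus Y) (hZ : IsSection S.Tplus Z) :
    S.η x (S.dBracket D X (fun y ↦ B y (Y y)) x) (B x (Z x))
      + S.η x (S.dBracket D (fun y ↦ B y (X y)) Y x) (B x (Z x))
      + S.η x (S.dBracket D (fun y ↦ B y (X y)) (fun y ↦ B y (Y y)) x) (Z x) =
    S.schoutenForm B X Y Z x := by
  have hBX := hB.isSection hX.1
  have hBY := hB.isSection hY.1
  have hBZ := hB.isSection hZ.1
  have e1 := S.η_dBracket D X (fun y ↦ B y (Y y)) (fun y ↦ B y (Z y)) x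
  have e2 := S.η_dBracket D (fun y ↦ B y (X y)) Y (fun y ↦ B y (Z y)) x
  have e3 := S.η_dBracket D (fun y ↦ B y (X y)) (fun y ↦ B y (Y y)) Z x
  have t1 := hD.n_adapted.torsion_left _ _ Z hBX hBY hZ x
  have t2 := hD.n_adapted.torsion_left _ _ Y hBX hBZ hY x
  have t3 := hD.n_adapted.torsion_left _ _ X hBY hBZ hX x
  have n1 := hD.p_adapted.η_deriv_Tminus (x := x) hZ hBX hBY
  have n2 := hD.p_adapted.η_deriv_Tminus (x := x) hY hBX hBZ
  have n3 := hD.p_adapted.η_deriv_Tminus (x := x) hX hBY hBZ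
  have m1 := hD.n_adapted.metric _ Y _ hBX hY.1 hBZ.1 x
  have m2 := hD.n_adapted.metric _ X _ hBY hX.1 hBZ.1 x
  have m3 := hD.n_adapted.metric _ X _ hBZ hX.1 hBY.1 x
  simp only [fun (V W : VF E P) (y : P) ↦ S.symm y (V y) (B y (W y))] at m1 m2 m3
  -- Two of the three derivatives of `η(B·, ·)` come from `m1` and `m3` with arguments opposite to
  -- the cyclic order of `schoutenForm`.
  have s2 := derivAlong_skew hB (fun y ↦ B y (Z y)) X Y x
  have s3 := derivAlong_skew hB (fun y ↦ B y (X y)) Y Z x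
  rw [S.symm x (Y x)] at m1
  rw [S.symm x (X x)] at m2 m3
  simp only [map_sub, _root_.sub_apply] at e1 e2 e3 t1 t2 t3
  have c := congrArg (S.η x (Y x)) (lie_swap (fun y ↦ B y (Z y)) (fun y ↦ B y (X y)) x)
  rw [map_neg] at c
  simp only [schoutenForm]
  rw [S.symm x (X x), c, S.symm x (Y x), S.symm x (Z x)]
  linarith

end DBracket

end AlmostParaHermitian

/-! ### Brackets of finite linear combinations -/

section

variable {E : Type*} [NormedAddCommGroup E] [NormedSpace ℝ E]
  {P : Type*} [TopologicalSpace P] [ChartedSpace E P]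

theorem derivAlong_fun_neg {f : P → ℝ} {X : VF E P} {x : P} :
    derivAlong X (fun y ↦ - f y) x = - derivAlong X f x := by
  simp [derivAlong, mvfderiv_fun_neg]

theorem derivAlong_fun_sub {f g : P → ℝ} {X : VF E P} {x : P} (hf : FunDiffAt (E := E) f x)
    (hg : FunDiffAt (E := E) g x) :
    derivAlong X (fun y ↦ f y - g y) x = derivAlong X f x - derivAlong X g x := by
  simp [derivAlong, mvfderiv_fun_sub hf hg]

theorem FunDiffAt.fun_mul {f g : P → ℝ} {x : P} (hf : FunDiffAt (E := E) f x)
    (hg : FunDiffAt (E := E) g x) : FunDiffAt (E := E) (fun y ↦ f y * g y) x :=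
  MDifferentiableAt.mul hf hg

theorem FunDiffAt.fun_sub {f g : P → ℝ} {x : P} (hf : FunDiffAt (E := E) f x)
    (hg : FunDiffAt (E := E) g x) : FunDiffAt (E := E) (fun y ↦ f y - g y) x :=
  MDifferentiableAt.sub hf hg

theorem derivAlong_direction_sum {ι : Type*} {s : Finset ι} {f : P → ℝ} {g : ι → P → ℝ}
    {X : ι → VF E P} {x : P} :
    derivAlong (fun y ↦ ∑ i ∈ s, g i y • X i y) f x = ∑ i ∈ s, g i x * derivAlong (X i) f x := by
  simp [derivAlong]

variable [IsManifold 𝓘(ℝ, E) ∞ P] [FiniteDimensional ℝ E]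

/-- The Leibniz rule in both arguments. Derivatives of coefficients are kept along the whole sums,
which later become `Bβ` and `Bγ`. -/
theorem lie_sum_smul {ι κ : Type*} {s : Finset ι} {t : Finset κ} {f : ι → P → ℝ} {g : κ → P → ℝ}
    {V : ι → VF E P} {W : κ → VF E P} {x : P} (hf : ∀ a, FunDiffAt (E := E) (f a) x)
    (hg : ∀ c, FunDiffAt (E := E) (g c) x) (hV : ∀ a, DiffAt (V a) x) (hW : ∀ c, DiffAt (W c) x) :
    lie (fun y ↦ ∑ a ∈ s, f a y • V a y) (fun y ↦ ∑ c ∈ t, g c y • W c y) x =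
      - ∑ a ∈ s, derivAlong (fun y ↦ ∑ c ∈ t, g c y • W c y) (f a) x • V a x
      + ∑ c ∈ t, derivAlong (fun y ↦ ∑ a ∈ s, f a y • V a y) (g c) x • W c x
      + ∑ a ∈ s, ∑ c ∈ t, (f a x * g c x) • lie (V a) (W c) x := by
  rw [lie_sum_left fun a _ ↦ (hV a).smul (hf a)]
  have h1 : ∀ a, lie (fun y ↦ f a y • V a y) (fun y ↦ ∑ c ∈ t, g c y • W c y) x =
      - derivAlong (fun y ↦ ∑ c ∈ t, g c y • W c y) (f a) x • V a x
      + (∑ c ∈ t, (f a x * derivAlong (V a) (g c) x) • W c x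
        + ∑ c ∈ t, (f a x * g c x) • lie (V a) (W c) x) := by
    intro a
    rw [lie_smul_left (hf a) (hV a), lie_sum_right fun c _ ↦ (hW c).smul (hg c), Finset.smul_sum,
      ← Finset.sum_add_distrib]
    congr 1
    refine Finset.sum_congr rfl fun c _ ↦ ?_
    rw [lie_smul_right (hg c) (hW c)]
    module
  simp only [h1, Finset.sum_add_distrib, neg_smul, Finset.sum_neg_distrib]
  rw [Finset.sum_comm, ← add_assoc]
  simp only [derivAlong_direction_sum, Finset.sum_smul]

end

/-! ### Local decompositions of `b` and the determinantal formula -/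

namespace AlmostParaHermitian

variable {E : Type*} [NormedAddCommGroup E] [NormedSpace ℝ E]
  {P : Type*} [TopologicalSpace P] [ChartedSpace E P] [IsManifold 𝓘(ℝ, E) ∞ P]
  {S : AlmostParaHermitian E P} {B : EndField E P}

variable (S) in
/-- The bivector field `∑ Xᵢ ∧ X'ᵢ` induces near `x` the endomorphism field `B`. -/
structure IsDecompositionAt (B : EndField E P) {ι : Type*} [Fintype ι] (X X' : ι → VF E P)
    (x : P) : Prop where
  smooth_left : ∀ i, SmoothAt (X i) x
  smooth_right : ∀ i, SmoothAt (X' i) x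
  eventually_eq : ∀ᶠ y in 𝓝 x, ∀ v, B y v =
    ∑ i, (S.η y v (X i y) • X' i y - S.η y v (X' i y) • X i y)

variable (S) in
/-- The sum `∑ R[α(Xᵢ)] β(X'ᵢ) - R[α(X'ᵢ)] β(Xᵢ)`. -/
def derivTerm {ι : Type*} [Fintype ι] (X X' : ι → VF E P) (x : P) (R α β : VF E P) : ℝ :=
  ∑ i, (derivAlong R (fun y ↦ S.η y (α y) (X i y)) x * S.η x (β x) (X' i x)
    - derivAlong R (fun y ↦ S.η y (α y) (X' i y)) x * S.η x (β x) (X i x))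

variable (S) in
/-- The contribution of `X ∧ X'` and `Y ∧ Y'` to the part of `α([Bβ, Bγ])` without derivatives of
coefficients. -/
def bracketSummand (X X' Y Y' : VF E P) (x : P) (α β γ : VF E P) : ℝ :=
  S.η x (β x) (X x) * S.η x (γ x) (Y x) * S.η x (α x) (lie X' Y' x)
    - S.η x (β x) (X x) * S.η x (γ x) (Y' x) * S.η x (α x) (lie X' Y x)
    - S.η x (β x) (X' x) * S.η x (γ x) (Y x) * S.η x (α x) (lie X Y' x)
    + S.η x (β x) (X' x) * S.η x (γ x) (Y' x) * S.η x (α x) (lie X Y x)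

variable (S) in
/-- The part of `α([Bβ, Bγ])` without derivatives of coefficients. -/
def bracketTerm {ι κ : Type*} [Fintype ι] [Fintype κ] (X X' : ι → VF E P) (Y Y' : κ → VF E P)
    (x : P) (α β γ : VF E P) : ℝ :=
  ∑ i, ∑ j, S.bracketSummand (X i) (X' i) (Y j) (Y' j) x α β γ

variable {x : P} {ι κ : Type*} [Fintype ι] [Fintype κ] {X X' : ι → VF E P} {Y Y' : κ → VF E P}

theorem IsDecompositionAt.derivAlong (h : S.IsDecompositionAt B X X' x) {R α β : VF E P}
    (hα : SmoothAt α x) (hβ : SmoothAt β x) :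
    derivAlong R (fun y ↦ S.η y (B y (α y)) (β y)) x =
      S.derivTerm X X' x R α β - S.derivTerm X X' x R β α := by
  have dX : ∀ i, ∀ γ : VF E P, SmoothAt γ x →
      FunDiffAt (E := E) (fun y ↦ S.η y (γ y) (X i y)) x := fun i γ hγ ↦
    S.smooth_η.funDiffAt hγ.diffAt (h.smooth_left i).diffAt
  have dX' : ∀ i, ∀ γ : VF E P, SmoothAt γ x →
      FunDiffAt (E := E) (fun y ↦ S.η y (γ y) (X' i y)) x := fun i γ hγ ↦
    S.smooth_η.funDiffAt hγ.diffAt (h.smooth_right i).diffAt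
  have h1 : ∀ᶠ y in 𝓝 x, S.η y (B y (α y)) (β y) =
      ∑ i, (S.η y (α y) (X i y) * S.η y (β y) (X' i y)
        - S.η y (α y) (X' i y) * S.η y (β y) (X i y)) := by
    filter_upwards [h.eventually_eq] with y hy
    rw [hy, S.symm]
    simp
  rw [derivAlong_congr h1, derivAlong_sum, derivTerm, derivTerm, ← Finset.sum_sub_distrib]
  · refine Finset.sum_congr rfl fun i _ ↦ ?_
    rw [derivAlong_fun_sub (FunDiffAt.fun_mul (dX i α hα) (dX' i β hβ))
      (FunDiffAt.fun_mul (dX' i α hα) (dX i β hβ)), derivAlong_mul (dX i α hα) (dX' i β hβ),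
      derivAlong_mul (dX' i α hα) (dX i β hβ)]
    ring
  · exact fun i _ ↦ FunDiffAt.fun_sub (FunDiffAt.fun_mul (dX i α hα) (dX' i β hβ))
      (FunDiffAt.fun_mul (dX' i α hα) (dX i β hβ))

variable [FiniteDimensional ℝ E]

/-- `Bβ` is expanded by one decomposition and `Bγ` by another, since `IsSchoutenBracket` allows its
two arguments to be decomposed independently. -/
theorem IsDecompositionAt.η_lie (h : S.IsDecompositionAt B X X' x)
    (h' : S.IsDecompositionAt B Y Y' x) {α β γ : VF E P}
    (hβ : SmoothAt β x) (hγ : SmoothAt γ x) :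
    S.η x (α x) (lie (fun y ↦ B y (β y)) (fun y ↦ B y (γ y)) x) =
      S.derivTerm Y Y' x (fun y ↦ B y (β y)) γ α - S.derivTerm X X' x (fun y ↦ B y (γ y)) β α
        + S.bracketTerm X X' Y Y' x α β γ := by
  -- `X ∧ X'` acts by `v ↦ η(v, X) X' - η(v, X') X`; the doubled index set lists these two summands
  -- separately.
  let f : ι ⊕ ι → P → ℝ :=
    Sum.elim (fun i y ↦ S.η y (β y) (X i y)) (fun i y ↦ - S.η y (β y) (X' i y))
  let g : κ ⊕ κ → P → ℝ :=
    Sum.elim (fun i y ↦ S.η y (γ y) (Y i y)) (fun i y ↦ - S.η y (γ y) (Y' i y))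
  let V : ι ⊕ ι → VF E P := Sum.elim X' X
  let W : κ ⊕ κ → VF E P := Sum.elim Y' Y
  have hf : ∀ a, FunDiffAt (E := E) (f a) x := by
    rintro (i | i)
    · exact S.smooth_η.funDiffAt hβ.diffAt (h.smooth_left i).diffAt
    · exact (S.smooth_η.funDiffAt hβ.diffAt (h.smooth_right i).diffAt).neg
  have hg : ∀ a, FunDiffAt (E := E) (g a) x := by
    rintro (i | i)
    · exact S.smooth_η.funDiffAt hγ.diffAt (h'.smooth_left i).diffAt
    · exact (S.smooth_η.funDiffAt hγ.diffAt (h'.smooth_right i).diffAt).neg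
  have hV : ∀ a, DiffAt (V a) x := by
    rintro (i | i)
    · exact (h.smooth_right i).diffAt
    · exact (h.smooth_left i).diffAt
  have hW : ∀ a, DiffAt (W a) x := by
    rintro (i | i)
    · exact (h'.smooth_right i).diffAt
    · exact (h'.smooth_left i).diffAt
  have e1 : ∀ᶠ y in 𝓝 x, B y (β y) = ∑ a, f a y • V a y := by
    filter_upwards [h.eventually_eq] with y hy
    simp [hy, f, V, sub_eq_add_neg, Finset.sum_add_distrib]
  have e2 : ∀ᶠ y in 𝓝 x, B y (γ y) = ∑ a, g a y • W a y := by
    filter_upwards [h'.eventually_eq] with y hy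
    simp [hy, g, W, sub_eq_add_neg, Finset.sum_add_distrib]
  have e3 : ∀ F, ParaHermitian.derivAlong (fun y ↦ ∑ a, f a y • V a y) F x =
      ParaHermitian.derivAlong (fun y ↦ B y (β y)) F x := fun F ↦ by
    simp only [ParaHermitian.derivAlong, e1.self_of_nhds]
  have e4 : ∀ F, ParaHermitian.derivAlong (fun y ↦ ∑ a, g a y • W a y) F x =
      ParaHermitian.derivAlong (fun y ↦ B y (γ y)) F x := fun F ↦ by
    simp only [ParaHermitian.derivAlong, e2.self_of_nhds]
  rw [lie_congr e1 e2, lie_sum_smul hf hg hV hW]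
  simp only [e3, e4]
  simp only [Fintype.sum_sum_type, f, g, V, W, Sum.elim_inl, Sum.elim_inr, derivAlong_fun_neg,
    map_add, map_neg, map_sum, map_smul, smul_eq_mul, derivTerm, bracketTerm, bracketSummand,
    Finset.sum_add_distrib, Finset.sum_sub_distrib, neg_mul, mul_neg, neg_smul,
    Finset.sum_neg_distrib]
  ring

/-- `schoutenForm` is computed with the two decompositions in either order and averaged. The
averaged derivatives of coefficients cancel in the cyclic sum. The bracket terms of the two orders
together supply all terms of the determinants, and the average is the factor `1/2` of
`schoutenDecomp`. -/
theorem IsDecompositionAt.schoutenForm_eq (h : S.IsDecompositionAt B X X' x)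
    (h' : S.IsDecompositionAt B Y Y' x) {α β γ : VF E P}
    (hα : SmoothAt α x) (hβ : SmoothAt β x) (hγ : SmoothAt γ x) :
    S.schoutenForm B α β γ x = ∑ i, ∑ j, schoutenDecomp (X i) (X' i) (Y j) (Y' j) x
      (S.η x (α x)) (S.η x (β x)) (S.η x (γ x)) := by
  have key : ∑ i, ∑ j, schoutenDecomp (X i) (X' i) (Y j) (Y' j) x
      (S.η x (α x)) (S.η x (β x)) (S.η x (γ x)) =
      (1 / 2 : ℝ) * ((S.bracketTerm X X' Y Y' x α β γ + S.bracketTerm X X' Y Y' x β γ α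
        + S.bracketTerm X X' Y Y' x γ α β) + (S.bracketTerm Y Y' X X' x α β γ
        + S.bracketTerm Y Y' X X' x β γ α + S.bracketTerm Y Y' X X' x γ α β)) := by
    have comm : ∀ α β γ, S.bracketTerm Y Y' X X' x α β γ =
        ∑ i, ∑ j, S.bracketSummand (Y j) (Y' j) (X i) (X' i) x α β γ :=
      fun _ _ _ ↦ Finset.sum_comm
    simp only [comm]
    simp only [bracketTerm, ← Finset.sum_add_distrib, Finset.mul_sum]
    refine Finset.sum_congr rfl fun i _ ↦ Finset.sum_congr rfl fun j _ ↦ ?_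
    simp only [bracketSummand, schoutenDecomp, wedge₃, Matrix.det_fin_three, Matrix.of_apply,
      Matrix.cons_val',
      Matrix.cons_val_zero, Matrix.cons_val_one, Matrix.cons_val]
    rw [lie_swap (Y j), lie_swap (Y j), lie_swap (Y' j), lie_swap (Y' j)]
    simp only [map_neg]
    ring
  rw [key, schoutenForm]
  linarith [h.η_lie h' (α := α) hβ hγ, h.η_lie h' (α := β) hγ hα, h.η_lie h' (α := γ) hα hβ,
    h'.η_lie h (α := α) hβ hγ, h'.η_lie h (α := β) hγ hα, h'.η_lie h (α := γ) hα hβ,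
    h.derivAlong (R := fun y ↦ B y (α y)) hβ hγ, h.derivAlong (R := fun y ↦ B y (β y)) hγ hα,
    h.derivAlong (R := fun y ↦ B y (γ y)) hα hβ,
    h'.derivAlong (R := fun y ↦ B y (α y)) hβ hγ, h'.derivAlong (R := fun y ↦ B y (β y)) hγ hα,
    h'.derivAlong (R := fun y ↦ B y (γ y)) hα hβ]

end AlmostParaHermitian

/-! ### Coordinate frames -/

section Frame

variable {E : Type*} [NormedAddCommGroup E] [NormedSpace ℝ E]
  {P : Type*} [TopologicalSpace P] [ChartedSpace E P]

theorem FunSmoothAt.sum {ι : Type*} {s : Finset ι} {f : ι → P → ℝ} {x : P}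
    (hf : ∀ i ∈ s, FunSmoothAt (E := E) (f i) x) :
    FunSmoothAt (E := E) (fun y ↦ ∑ i ∈ s, f i y) x := contMDiffAt_finsetSum hf

theorem FunSmoothAt.det {ι : Type*} [Fintype ι] [DecidableEq ι] {A : P → Matrix ι ι ℝ} {x : P}
    (hA : ∀ i j, FunSmoothAt (E := E) (fun y ↦ A y i j) x) :
    FunSmoothAt (E := E) (fun y ↦ (A y).det) x := by
  simp only [Matrix.det_apply']
  exact FunSmoothAt.sum fun σ _ ↦ contMDiffAt_const.mul
    (contMDiffAt_finsetProd fun i _ ↦ hA (σ i) i)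

theorem FunSmoothAt.matrix_inv {ι : Type*} [Fintype ι] [DecidableEq ι] {A : P → Matrix ι ι ℝ}
    {x : P} (hA : ∀ i j, FunSmoothAt (E := E) (fun y ↦ A y i j) x) (h : (A x).det ≠ 0) (i j : ι) :
    FunSmoothAt (E := E) (fun y ↦ (A y)⁻¹ i j) x := by
  -- Cramer's rule: the entries of the inverse are quotients of determinants.
  have : (fun y ↦ (A y)⁻¹ i j) =
      fun y ↦ ((A y).det)⁻¹ * ((A y).updateRow j (Pi.single i 1)).det := by
    ext y
    rw [Matrix.inv_def, Ring.inverse_eq_inv', Matrix.smul_apply, Matrix.adjugate_apply, smul_eq_mul]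
  rw [this]
  refine ((FunSmoothAt.det hA).inv₀ h).mul (FunSmoothAt.det fun k l ↦ ?_)
  by_cases hk : k = j
  · subst hk
    simpa using contMDiffAt_const
  · simpa [Matrix.updateRow_ne hk] using hA k l

/-- The domain of the preferred chart at `c`. -/
def frameDomain (E : Type*) [NormedAddCommGroup E] [NormedSpace ℝ E]
    {P : Type*} [TopologicalSpace P] [ChartedSpace E P] (c : P) : Set P := (chartAt E c).source

theorem isOpen_frameDomain (c : P) : IsOpen (frameDomain E c) := (chartAt E c).open_source

theorem mem_frameDomain (c : P) : c ∈ frameDomain E c := mem_chart_source E c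

variable [IsManifold 𝓘(ℝ, E) ∞ P] [FiniteDimensional ℝ E]

/-- The indices of the coordinate frames. -/
abbrev FrameIndex (E : Type*) [NormedAddCommGroup E] [NormedSpace ℝ E] := Fin (Module.finrank ℝ E)

/-- The coordinate frame of the preferred chart at `c`. -/
def frame (c : P) (k : FrameIndex E) : VF E P :=
  (trivializationAt E (TangentSpace 𝓘(ℝ, E)) c).localFrame (Module.finBasis ℝ E) k

/-- The coordinate coframe of the preferred chart at `c`. -/
def coframe (c : P) (k : FrameIndex E) (y : P) : TangentSpace 𝓘(ℝ, E) y →ₗ[ℝ] ℝ :=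
  (trivializationAt E (TangentSpace 𝓘(ℝ, E)) c).localFrameCoeff 𝓘(ℝ, E) (Module.finBasis ℝ E) k y

variable {c x : P}

theorem smoothAt_frame (hx : x ∈ frameDomain E c) (k : FrameIndex E) : SmoothAt (frame c k) x :=
  contMDiffAt_localFrame_of_mem ∞ _ (Module.finBasis ℝ E) k hx

theorem coframe_smoothAt (hx : x ∈ frameDomain E c) {X : VF E P} (hX : SmoothAt X x)
    (k : FrameIndex E) : FunSmoothAt (E := E) (fun y ↦ coframe c k y (X y)) x :=
  contMDiffAt_localFrameCoeff (Module.finBasis ℝ E) hx hX k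

theorem coframe_diffAt (hx : x ∈ frameDomain E c) {X : VF E P} (hX : DiffAt X x)
    (k : FrameIndex E) : FunDiffAt (E := E) (fun y ↦ coframe c k y (X y)) x :=
  mdifferentiableAt_localFrameCoeff (Module.finBasis ℝ E) hx hX k

theorem eq_sum_coframe (hx : x ∈ frameDomain E c) (v : TangentSpace 𝓘(ℝ, E) x) :
    v = ∑ k, coframe c k x v • frame c k x := by
  obtain ⟨X, rfl⟩ : ∃ X : VF E P, X x = v := ⟨fun y ↦ FiberBundle.extend E v y, by simp⟩
  exact (trivializationAt E (TangentSpace 𝓘(ℝ, E)) c).eq_sum_localFrameCoeff_smul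
    (b := Module.finBasis ℝ E) (I := 𝓘(ℝ, E)) (s := X) hx

theorem coframe_frame (hx : x ∈ frameDomain E c) (k l : FrameIndex E) :
    coframe c k x (frame c l x) = if l = k then 1 else 0 := by
  have := (trivializationAt E (TangentSpace 𝓘(ℝ, E)) c).localFrameCoeff_apply_of_mem_baseSet
    (I := 𝓘(ℝ, E)) (Module.finBasis ℝ E) hx (frame c l) k
  rw [coframe, this, frame, Bundle.Trivialization.localFrame_apply_of_mem_baseSet _ _ hx,
    Module.Basis.repr_self, Finsupp.single_apply]

end Frame

/-! ### The `η`-dual of a coordinate frame -/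

namespace AlmostParaHermitian

variable {E : Type*} [NormedAddCommGroup E] [NormedSpace ℝ E] [FiniteDimensional ℝ E]
  {P : Type*} [TopologicalSpace P] [ChartedSpace E P] [IsManifold 𝓘(ℝ, E) ∞ P]
  (S : AlmostParaHermitian E P)

/-- The Gram matrix of a coordinate frame. -/
def gram (c y : P) : Matrix (FrameIndex E) (FrameIndex E) ℝ :=
  .of fun k l ↦ S.η y (frame c k y) (frame c l y)

/-- The `η`-dual frame of a coordinate frame. -/
def dualFrame (c : P) (k : FrameIndex E) : VF E P :=
  fun y ↦ ∑ l, (S.gram c y)⁻¹ l k • frame c l y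

variable {S} {c x : P}

theorem det_gram_ne_zero (hx : x ∈ frameDomain E c) : (S.gram c x).det ≠ 0 := by
  intro h
  obtain ⟨a, ha, h0⟩ := Matrix.exists_mulVec_eq_zero_iff.2 h
  apply ha
  have h1 : ∑ l, a l • frame c l x = 0 := by
    refine S.nondegenerate x _ fun w ↦ ?_
    rw [eq_sum_coframe hx w, map_sum]
    refine Finset.sum_eq_zero fun k _ ↦ ?_
    have h2 := congrFun h0 k
    simp only [Matrix.mulVec, dotProduct, gram, Matrix.of_apply, Pi.zero_apply] at h2
    rw [map_smul, S.symm, map_sum]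
    simp only [map_smul, smul_eq_mul]
    simp only [mul_comm (a _), h2, mul_zero]
  ext k
  have h3 := congrArg (coframe c k x) h1
  simpa [coframe_frame hx] using h3

theorem smoothAt_dualFrame (hx : x ∈ frameDomain E c) (k : FrameIndex E) :
    SmoothAt (S.dualFrame c k) x :=
  SmoothAt.sum fun l _ ↦ SmoothAt.smul (FunSmoothAt.matrix_inv
    (fun i j ↦ S.smooth_η.funSmoothAt (smoothAt_frame hx i) (smoothAt_frame hx j))
    (det_gram_ne_zero hx) l k) (smoothAt_frame hx l)

theorem η_frame_dualFrame (hx : x ∈ frameDomain E c) (k l : FrameIndex E) :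
    S.η x (frame c k x) (S.dualFrame c l x) = if k = l then 1 else 0 := by
  have h := congrFun (congrFun (Matrix.mul_nonsing_inv (S.gram c x)
    (Ne.isUnit (det_gram_ne_zero hx))) k) l
  rw [Matrix.mul_apply, Matrix.one_apply] at h
  rw [← h, dualFrame, map_sum]
  exact Finset.sum_congr rfl fun m _ ↦ by rw [map_smul, smul_eq_mul, mul_comm]; rfl

theorem η_dualFrame (hx : x ∈ frameDomain E c) (k : FrameIndex E) (v : TangentSpace 𝓘(ℝ, E) x) :
    S.η x (S.dualFrame c k x) v = coframe c k x v := by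
  conv_lhs => rw [eq_sum_coframe hx v]
  rw [map_sum, Finset.sum_eq_single k]
  · rw [map_smul, S.symm, η_frame_dualFrame hx, if_pos rfl, smul_eq_mul, mul_one]
  · intro l _ hl
    rw [map_smul, S.symm, η_frame_dualFrame hx, if_neg hl, smul_zero]
  · simp

theorem eq_sum_dualFrame (hx : x ∈ frameDomain E c) (v : TangentSpace 𝓘(ℝ, E) x) :
    v = ∑ k, S.η x v (frame c k x) • S.dualFrame c k x := by
  rw [← sub_eq_zero]
  refine S.nondegenerate x _ fun w ↦ ?_
  rw [map_sub, _root_.sub_apply, sub_eq_zero]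
  conv_lhs => rw [eq_sum_coframe hx w]
  simp [η_dualFrame hx, mul_comm]

/-! ### The Schouten bracket -/

variable {B : EndField E P}

theorem sharp_η (v : TangentSpace 𝓘(ℝ, E) x) : S.sharp x (S.η x v) = v := by
  rw [← sub_eq_zero]
  refine S.nondegenerate x _ fun w ↦ ?_
  rw [map_sub, η_sharp, sub_self, _root_.zero_apply]

theorem apply_eq_sum_of_bivector {ι : Type*} [Fintype ι] {X X' : ι → VF E P}
    (h : ∀ α β, S.bivector B x α β = ∑ i, wedge₂ (X i) (X' i) x α β)
    (v : TangentSpace 𝓘(ℝ, E) x) :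
    B x v = ∑ i, (S.η x v (X i x) • X' i x - S.η x v (X' i x) • X i x) := by
  rw [← sub_eq_zero]
  refine S.nondegenerate x _ fun w ↦ ?_
  have h1 := h (S.η x v) (S.η x w)
  simp only [bivector, sharp_η, wedge₂] at h1
  rw [map_sub, _root_.sub_apply, h1, S.symm, sub_eq_zero]
  simp

theorem isDecompositionAt_of_bivector {ι : Type*} [Fintype ι] {X X' : ι → VF E P} {U : Set P}
    (hU : IsOpen U) (hX : ∀ i, SmoothOn (X i) U) (hX' : ∀ i, SmoothOn (X' i) U)
    (h : ∀ y ∈ U, ∀ α β, S.bivector B y α β = ∑ i, wedge₂ (X i) (X' i) y α β) (hx : x ∈ U) :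
    S.IsDecompositionAt B X X' x where
  smooth_left i := (hX i).smoothAt hU hx
  smooth_right i := (hX' i).smoothAt hU hx
  eventually_eq := by
    filter_upwards [hU.mem_nhds hx] with y hy using apply_eq_sum_of_bivector (h y hy)

/-- Expanding `P₊v` in the dual frame gives `Bv = ∑ η(v, P₋Vₖ) BVᵏ`, with all vectors in `T₋`. As
`b` is skew it equals the antisymmetrisation of this tensor, whence the `1/2`. -/
theorem bivector_eq_sum (hB : S.IsSkewMap B) (hx : x ∈ frameDomain E c)
    (α β : TangentSpace 𝓘(ℝ, E) x →L[ℝ] ℝ) :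
    S.bivector B x α β = ∑ k, wedge₂ (fun y ↦ (1 / 2 : ℝ) • S.negProj y (frame c k y))
      (fun y ↦ B y (S.dualFrame c k y)) x α β := by
  have key : ∀ v w, S.η x (B x v) w =
      ∑ k, S.η x v (S.negProj x (frame c k x)) * S.η x w (B x (S.dualFrame c k x)) := by
    intro v w
    conv_lhs => rw [hB.apply_eq, eq_sum_dualFrame (S := S) hx (S.posProj x v)]
    simp only [map_sum, map_smul, η_posProj_left]
    rw [_root_.sum_apply]
    refine Finset.sum_congr rfl fun k _ ↦ ?_
    rw [S.symm x w]
    rfl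
  obtain ⟨v, rfl⟩ : ∃ v, S.η x v = α := ⟨_, S.η_sharp x α⟩
  obtain ⟨w, rfl⟩ : ∃ w, S.η x w = β := ⟨_, S.η_sharp x β⟩
  have h1 := key v w
  have h2 := key w v
  rw [hB.η_apply] at h2
  have h3 : S.η x (B x v) w = (1 / 2 : ℝ) * (S.η x (B x v) w + S.η x (B x v) w) := by ring
  simp only [bivector, sharp_η, wedge₂]
  rw [h3]
  nth_rewrite 1 [h1]
  rw [← neg_neg (S.η x (B x v) w), h2, ← sub_eq_add_neg, ← Finset.sum_sub_distrib, Finset.mul_sum]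
  refine Finset.sum_congr rfl fun k _ ↦ ?_
  simp only [map_smul, smul_eq_mul]
  ring

variable [T2Space P] [SigmaCompactSpace P]

/-- `schouten` is a choice with default value 0, so existence comes first: `schoutenForm` on
arbitrary smooth extensions of the arguments qualifies, by `schoutenForm_eq`. -/
theorem schouten_eq (hB : S.IsSkewMap B) {X Y Z : VF E P} (hX : Smooth X) (hY : Smooth Y)
    (hZ : Smooth Z) (x : P) :
    schouten S.Tminus (S.bivector B) (S.bivector B) x (S.η x (X x)) (S.η x (Y x)) (S.η x (Z x)) =
      S.schoutenForm B X Y Z x := by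
  have ex : ∃ T, IsSchoutenBracket S.Tminus (S.bivector B) (S.bivector B) T := by
    choose ext ext_smooth ext_eq using fun (x : P) (v : TangentSpace 𝓘(ℝ, E) x) ↦
      exists_smooth_eq x v
    refine ⟨fun x α β γ ↦ S.schoutenForm B (ext x (S.sharp x α)) (ext x (S.sharp x β))
      (ext x (S.sharp x γ)) x, ?_⟩
    intro U hU m n X X' Y Y' hX hX' hY hY' h h' x hx α β γ
    have d := isDecompositionAt_of_bivector hU (fun i ↦ (hX i).1) (fun i ↦ (hX' i).1) h hx
    have d' := isDecompositionAt_of_bivector hU (fun i ↦ (hY i).1) (fun i ↦ (hY' i).1) h' hx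
    beta_reduce
    rw [d.schoutenForm_eq d' (ext_smooth x _ x) (ext_smooth x _ x) (ext_smooth x _ x)]
    simp only [ext_eq, η_sharp]
  rw [schouten, dif_pos ex]
  -- The chosen trivector is known only through decompositions, so it is evaluated on the one given
  -- by the coordinate frame at `x`.
  have hU := isOpen_frameDomain (E := E) x
  have hl : ∀ k, SmoothOn (fun y ↦ (1 / 2 : ℝ) • S.negProj y (frame x k y)) (frameDomain E x) :=
    fun k y hy ↦ (SmoothAt.smul contMDiffAt_const
      (smoothAt_negProj (smoothAt_frame hy k))).contMDiffWithinAt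
  have hr : ∀ k, SmoothOn (fun y ↦ B y (S.dualFrame x k y)) (frameDomain E x) :=
    fun k y hy ↦ (hB.smooth.smoothAt (smoothAt_dualFrame hy k)).contMDiffWithinAt
  have hl' : ∀ k, ∀ y ∈ frameDomain E x,
      (1 / 2 : ℝ) • S.negProj y (frame x k y) ∈ S.Tminus y :=
    fun k y _ ↦ Submodule.smul_mem _ _ (negProj_mem S _)
  have hr' : ∀ k, ∀ y ∈ frameDomain E x, B y (S.dualFrame x k y) ∈ S.Tminus y :=
    fun k y _ ↦ hB.mem _
  have h : ∀ y ∈ frameDomain E x, ∀ α β, S.bivector B y α β = _ :=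
    fun y hy ↦ bivector_eq_sum hB hy
  rw [ex.choose_spec _ hU _ _ _ _ _ _ (fun k ↦ ⟨hl k, hl' k⟩) (fun k ↦ ⟨hr k, hr' k⟩)
    (fun k ↦ ⟨hl k, hl' k⟩) (fun k ↦ ⟨hr k, hr' k⟩) h h x (mem_frameDomain x)]
  have d := isDecompositionAt_of_bivector hU hl hr h (mem_frameDomain x)
  rw [d.schoutenForm_eq d (hX x) (hY x) (hZ x)]

end AlmostParaHermitian

/-! ### Coordinate vector fields commute -/

section CoordinateBrackets

variable {E : Type*} [NormedAddCommGroup E] [NormedSpace ℝ E] [FiniteDimensional ℝ E]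
  {P : Type*} [TopologicalSpace P] [ChartedSpace E P] [IsManifold 𝓘(ℝ, E) ∞ P]
  {c x : P}

/-- The constant vector fields on `E` given by the vectors of a basis. -/
def constFrame (E : Type*) [NormedAddCommGroup E] [NormedSpace ℝ E] [FiniteDimensional ℝ E]
    (k : FrameIndex E) : VF E E := fun _ ↦ Module.finBasis ℝ E k

theorem lie_constFrame (k l : FrameIndex E) (y : E) :
    VectorField.mlieBracket 𝓘(ℝ, E) (constFrame E k) (constFrame E l) y = 0 := by
  have h := congrFun (VectorField.mlieBracketWithin_eq_lieBracketWithin (V := constFrame E k)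
    (W := constFrame E l) (s := Set.univ)) y
  rw [VectorField.mlieBracketWithin_univ] at h
  have h1 : VectorField.lieBracketWithin ℝ (fun _ : E ↦ Module.finBasis ℝ E k)
      (fun _ : E ↦ Module.finBasis ℝ E l) Set.univ y = 0 := by
    simp [VectorField.lieBracketWithin_univ, VectorField.lieBracket]
  exact h.trans h1

theorem frame_eq_symmL (hx : x ∈ frameDomain E c) (k : FrameIndex E) :
    frame c k x = (trivializationAt E (TangentSpace 𝓘(ℝ, E)) c).symmL ℝ x
      (Module.finBasis ℝ E k) := by
  rw [frame, Bundle.Trivialization.localFrame_apply_of_mem_baseSet _ _ hx]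
  simp only [Bundle.Trivialization.basisAt, Module.Basis.map_apply]
  exact (Bundle.Trivialization.symmL_apply (R := ℝ)
    (trivializationAt E (TangentSpace 𝓘(ℝ, E)) c) hx _).symm

theorem frame_eq_mpullback (hx : x ∈ frameDomain E c) (k : FrameIndex E) :
    frame c k x = VectorField.mpullback 𝓘(ℝ, E) 𝓘(ℝ, E) (extChartAt 𝓘(ℝ, E) c)
      (constFrame E k) x := by
  have hx' : x ∈ (extChartAt 𝓘(ℝ, E) c).source := by rwa [extChartAt_source]
  have h1 := isInvertible_mfderiv_extChartAt (I := 𝓘(ℝ, E)) hx'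
  rw [VectorField.mpullback_apply, eq_comm, h1.inverse_apply_eq,
    ← TangentBundle.continuousLinearMapAt_trivializationAt hx, frame_eq_symmL hx]
  exact ((trivializationAt E (TangentSpace 𝓘(ℝ, E)) c).continuousLinearMapAt_symmL
    (R := ℝ) hx _).symm

/-- Coordinate fields are chart pullbacks of constant fields, and pullback respects brackets. -/
theorem lie_frame (hx : x ∈ frameDomain E c) (k l : FrameIndex E) :
    lie (frame c k) (frame c l) x = 0 := by
  have h : ∀ k, ∀ᶠ y in 𝓝 x, frame c k y =
      VectorField.mpullback 𝓘(ℝ, E) 𝓘(ℝ, E) (extChartAt 𝓘(ℝ, E) c) (constFrame E k) y :=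
    fun k ↦ by
      filter_upwards [(isOpen_frameDomain c).mem_nhds hx] with y hy using frame_eq_mpullback hy k
  have hd : ∀ k (y : E), MDifferentiableAt 𝓘(ℝ, E) (𝓘(ℝ, E).prod 𝓘(ℝ, E))
      (fun y ↦ (⟨y, constFrame E k y⟩ : TangentBundle 𝓘(ℝ, E) E)) y := fun k y ↦ by
    rw [mdifferentiableAt_section]
    simpa [constFrame] using! mdifferentiableAt_const
  have : IsManifold 𝓘(ℝ, E) (minSmoothness ℝ 2) P := by
    rw [minSmoothness_of_isRCLikeNormedField]
    exact .of_le (n := ∞) (by exact WithTop.coe_le_coe.2 (le_top (a := (2 : ℕ∞))))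
  rw [lie_congr (h k) (h l), lie, ← VectorField.mpullback_mlieBracket (n := ∞) (hd k _) (hd l _)
    (contMDiffAt_extChartAt' hx) (by
      rw [minSmoothness_of_isRCLikeNormedField]
      exact WithTop.coe_le_coe.2 (le_top (a := (2 : ℕ∞)))), VectorField.mpullback_apply, lie_constFrame, map_zero]

end CoordinateBrackets

/-! ### Smoothness and brackets in coordinates -/

section LocalConnections

theorem FunDiffAt.fun_add {E : Type*} [NormedAddCommGroup E] [NormedSpace ℝ E]
    {P : Type*} [TopologicalSpace P] [ChartedSpace E P] {f g : P → ℝ} {x : P}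
    (hf : FunDiffAt (E := E) f x) (hg : FunDiffAt (E := E) g x) :
    FunDiffAt (E := E) (fun y ↦ f y + g y) x :=
  MDifferentiableAt.add hf hg

theorem derivAlong_fun_add {E : Type*} [NormedAddCommGroup E] [NormedSpace ℝ E]
    {P : Type*} [TopologicalSpace P] [ChartedSpace E P]
    {f g : P → ℝ} {X : VF E P} {x : P} (hf : FunDiffAt (E := E) f x)
    (hg : FunDiffAt (E := E) g x) :
    derivAlong X (fun y ↦ f y + g y) x = derivAlong X f x + derivAlong X g x := by
  simp [derivAlong, mvfderiv_fun_add hf hg]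

variable {E : Type*} [NormedAddCommGroup E] [NormedSpace ℝ E] [FiniteDimensional ℝ E]
  {P : Type*} [TopologicalSpace P] [ChartedSpace E P] [IsManifold 𝓘(ℝ, E) ∞ P]
  {c x : P}

/-- The field of endomorphisms `A` is smooth at `x`. -/
def SmoothEndAt (A : EndField E P) (x : P) : Prop :=
  ContMDiffAt 𝓘(ℝ, E) (𝓘(ℝ, E).prod 𝓘(ℝ, E →L[ℝ] E)) ∞
    (fun x ↦ Bundle.TotalSpace.mk' (E →L[ℝ] E)
      (E := fun x : P ↦ TangentSpace 𝓘(ℝ, E) x →L[ℝ] TangentSpace 𝓘(ℝ, E) x) x (A x)) x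

omit [IsManifold 𝓘(ℝ, E) ∞ P] in
theorem contMDiffAt_clm_of_basis {A : P → E →L[ℝ] E}
    (hA : ∀ k : FrameIndex E, ContMDiffAt 𝓘(ℝ, E) 𝓘(ℝ, E) ∞
      (fun y ↦ A y (Module.finBasis ℝ E k)) x) :
    ContMDiffAt 𝓘(ℝ, E) 𝓘(ℝ, E →L[ℝ] E) ∞ A x := by
  have : A = fun y ↦ ∑ k : FrameIndex E, ContinuousLinearMap.smulRightL ℝ E E
      ((Module.finBasis ℝ E).coord k).toContinuousLinearMap (A y (Module.finBasis ℝ E k)) := by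
    ext y v
    conv_lhs => rw [← (Module.finBasis ℝ E).sum_repr v]
    simp only [map_sum, map_smul]
    simp
  rw [this]
  exact contMDiffAt_finsetSum fun k _ ↦
    (ContinuousLinearMap.contMDiff _).contMDiffAt.comp x (hA k)

/-- In the trivialisation at `x` the frame is a constant basis, so these fields are the columns of
`A`. -/
theorem smoothEndAt_of_frame {A : EndField E P}
    (hA : ∀ k, SmoothAt (fun y ↦ A y (frame x k y)) x) : SmoothEndAt A x := by
  rw [SmoothEndAt, contMDiffAt_hom_bundle]
  refine ⟨contMDiffAt_id, contMDiffAt_clm_of_basis fun k ↦ ?_⟩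
  have h := hA k
  rw [SmoothAt, Bundle.contMDiffAt_section] at h
  refine h.congr_of_eventuallyEq ?_
  filter_upwards [(isOpen_frameDomain (E := E) x).mem_nhds (mem_frameDomain (E := E) x)] with y hy
  rw [ContinuousLinearMap.inCoordinates, ContinuousLinearMap.comp_apply,
    ContinuousLinearMap.comp_apply, frame_eq_symmL hy]
  exact Bundle.Trivialization.continuousLinearMapAt_apply_of_mem (R := ℝ)
    (trivializationAt E (TangentSpace 𝓘(ℝ, E)) x) hy _

/-- The flat coordinate connection is torsion-free; this is the source of the torsion conditions for
adapted connections. -/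
theorem lie_eq_sum_frame (hx : x ∈ frameDomain E c) {X Y : VF E P} (hX : DiffAt X x)
    (hY : DiffAt Y x) : lie X Y x = ∑ k, (derivAlong X (fun y ↦ coframe c k y (Y y)) x
      - derivAlong Y (fun y ↦ coframe c k y (X y)) x) • frame c k x := by
  have h : ∀ X : VF E P, ∀ᶠ y in 𝓝 x, X y = ∑ k, coframe c k y (X y) • frame c k y := fun X ↦ by
    filter_upwards [(isOpen_frameDomain c).mem_nhds hx] with y hy using eq_sum_coframe hy (X y)
  have hd : ∀ (X : VF E P) (f : P → ℝ),
      derivAlong (fun y ↦ ∑ k, coframe c k y (X y) • frame c k y) f x = derivAlong X f x :=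
    fun X f ↦ by simp only [derivAlong, ← eq_sum_coframe hx]
  rw [lie_congr (h X) (h Y), lie_sum_smul (fun k ↦ coframe_diffAt hx hX k)
    (fun k ↦ coframe_diffAt hx hY k) (fun k ↦ (smoothAt_frame hx k).diffAt)
    (fun k ↦ (smoothAt_frame hx k).diffAt)]
  simp only [hd, lie_frame hx, smul_zero, Finset.sum_const_zero, add_zero, sub_smul,
    Finset.sum_sub_distrib]
  abel

end LocalConnections

/-! ### Local connections of an isotropic splitting -/

namespace AlmostParaHermitian

variable {E : Type*} [NormedAddCommGroup E] [NormedSpace ℝ E] [FiniteDimensional ℝ E]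
  {P : Type*} [TopologicalSpace P] [ChartedSpace E P] [IsManifold 𝓘(ℝ, E) ∞ P]
  (S : AlmostParaHermitian E P)

/-- `Q` and `R` are the projections of a smooth splitting of `TP` into `η`-isotropic subbundles. -/
structure IsSplitting (Q R : EndField E P) : Prop where
  smooth_left : SmoothEnd Q
  smooth_right : SmoothEnd R
  add_apply : ∀ x v, Q x v + R x v = v
  left_left : ∀ x v, Q x (Q x v) = Q x v
  η_left : ∀ x v w, S.η x (Q x v) w = S.η x v (R x w)

/-- The partial connection along the range of `Q` for which the fields `Q Vₖ` and `R Vᵏ` are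
parallel, where `Vₖ` is the coordinate frame at `c` and `Vᵏ` the `η`-dual frame. -/
def partialConnection (Q R : EndField E P) (c : P) (Y : VF E P) : EndField E P := fun x ↦
  ∑ k, (((mvfderiv 𝓘(ℝ, E) (fun y ↦ coframe c k y (Q y (Y y))) x).comp (Q x)).smulRight
      (Q x (frame c k x))
    + ((mvfderiv 𝓘(ℝ, E) (fun y ↦ S.η y (R y (Y y)) (frame c k y)) x).comp (Q x)).smulRight
      (R x (S.dualFrame c k x)))

variable {S} {Q R : EndField E P} {c x : P} {X Y Z : VF E P}

theorem partialConnection_apply : S.partialConnection Q R c Y x (X x) =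
    ∑ k, (derivAlong (fun y ↦ Q y (X y)) (fun y ↦ coframe c k y (Q y (Y y))) x •
        Q x (frame c k x)
      + derivAlong (fun y ↦ Q y (X y)) (fun y ↦ S.η y (R y (Y y)) (frame c k y)) x •
        R x (S.dualFrame c k x)) := by
  rw [partialConnection, _root_.sum_apply]
  rfl

namespace IsSplitting

variable (h : S.IsSplitting Q R)
include h

omit [FiniteDimensional ℝ E] in
theorem right_left (v : TangentSpace 𝓘(ℝ, E) x) : R x (Q x v) = 0 := by
  simpa [h.left_left] using h.add_apply x (Q x v)

omit [FiniteDimensional ℝ E] in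
theorem left_right (v : TangentSpace 𝓘(ℝ, E) x) : Q x (R x v) = 0 := by
  have h1 := congrArg (Q x) (h.add_apply x v)
  simpa [h.left_left] using h1

omit [FiniteDimensional ℝ E] in
theorem right_right (v : TangentSpace 𝓘(ℝ, E) x) : R x (R x v) = R x v := by
  simpa [h.left_right] using h.add_apply x (R x v)

omit [FiniteDimensional ℝ E] in
theorem η_right (v w : TangentSpace 𝓘(ℝ, E) x) : S.η x (R x v) w = S.η x v (Q x w) := by
  rw [S.symm, ← h.η_left, S.symm]

omit [FiniteDimensional ℝ E] in
theorem swap : S.IsSplitting R Q where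
  smooth_left := h.smooth_right
  smooth_right := h.smooth_left
  add_apply x v := by rw [add_comm, h.add_apply]
  left_left _ v := h.right_right v
  η_left _ v w := h.η_right v w

omit [FiniteDimensional ℝ E] in
theorem η_eq (v w : TangentSpace 𝓘(ℝ, E) x) :
    S.η x v w = S.η x (Q x v) (R x w) + S.η x (R x v) (Q x w) := by
  rw [h.η_left, h.η_right, h.right_right, h.left_left, ← map_add, add_comm, h.add_apply]

omit [FiniteDimensional ℝ E] in
theorem right_eq_self_iff {v : TangentSpace 𝓘(ℝ, E) x} : R x v = v ↔ Q x v = 0 := by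
  have := h.add_apply x v
  refine ⟨fun h1 ↦ ?_, fun h1 ↦ ?_⟩
  · rwa [h1, add_eq_right] at this
  · rwa [h1, zero_add] at this

theorem η_eq_sum (hx : x ∈ frameDomain E c) (v w : TangentSpace 𝓘(ℝ, E) x) :
    S.η x v w = ∑ k, (coframe c k x (Q x v) * S.η x (R x w) (frame c k x)
      + coframe c k x (Q x w) * S.η x (R x v) (frame c k x)) := by
  have key : ∀ v w, S.η x (Q x v) w = ∑ k, coframe c k x (Q x v) * S.η x w (frame c k x) := by
    intro v w
    conv_lhs => rw [eq_sum_coframe hx (Q x v), S.symm]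
    simp
  rw [h.η_eq, key, S.symm x (R x v), key, ← Finset.sum_add_distrib]

theorem coframe_diffAt (hx : x ∈ frameDomain E c) (hY : DiffAt Y x) (k : FrameIndex E) :
    FunDiffAt (E := E) (fun y ↦ coframe c k y (Q y (Y y))) x :=
  ParaHermitian.coframe_diffAt hx (h.smooth_left.diffAt hY) k

theorem η_frame_diffAt (hx : x ∈ frameDomain E c) (hY : DiffAt Y x) (k : FrameIndex E) :
    FunDiffAt (E := E) (fun y ↦ S.η y (R y (Y y)) (frame c k y)) x :=
  S.smooth_η.funDiffAt (h.smooth_right.diffAt hY) (smoothAt_frame hx k).diffAt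

theorem smoothAt_partialConnection (hx : x ∈ frameDomain E c) (hX : SmoothAt X x)
    (hY : SmoothAt Y x) : SmoothAt (fun y ↦ S.partialConnection Q R c Y y (X y)) x := by
  simp only [partialConnection_apply]
  have hQ := h.smooth_left.smoothAt hX
  refine SmoothAt.sum fun k _ ↦ SmoothAt.add
    (SmoothAt.smul (hQ.derivAlong (coframe_smoothAt hx (h.smooth_left.smoothAt hY) k))
      (h.smooth_left.smoothAt (smoothAt_frame hx k)))
    (SmoothAt.smul (hQ.derivAlong (S.smooth_η.funSmoothAt (h.smooth_right.smoothAt hY)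
      (smoothAt_frame hx k))) (h.smooth_right.smoothAt (smoothAt_dualFrame hx k)))

theorem partialConnection_add (hx : x ∈ frameDomain E c) (hY : DiffAt Y x) (hZ : DiffAt Z x) :
    S.partialConnection Q R c (Y + Z) x =
      S.partialConnection Q R c Y x + S.partialConnection Q R c Z x := by
  simp only [partialConnection, ← Finset.sum_add_distrib]
  refine Finset.sum_congr rfl fun k _ ↦ ?_
  have h1 := mvfderiv_fun_add (h.coframe_diffAt hx hY k) (h.coframe_diffAt hx hZ k)
  have h2 := mvfderiv_fun_add (h.η_frame_diffAt hx hY k) (h.η_frame_diffAt hx hZ k)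
  simp only [Pi.add_apply, map_add, _root_.add_apply, h1, h2]
  ext v
  simp only [_root_.add_apply, ContinuousLinearMap.smulRight_apply,
    ContinuousLinearMap.comp_apply, add_smul]
  abel

/-- The Leibniz rule holds only along the range of `Q`. Adding the partial connection along `R`
completes it, because `Q + R = 1`. -/
theorem partialConnection_smul (hx : x ∈ frameDomain E c) {g : P → ℝ} (hY : DiffAt Y x)
    (hg : FunDiffAt (E := E) g x) :
    S.partialConnection Q R c (g • Y) x = g x • S.partialConnection Q R c Y x +
      ((mvfderiv 𝓘(ℝ, E) g x).comp (Q x)).smulRight (Y x) := by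
  have h0 : Y x = ∑ k, (coframe c k x (Q x (Y x)) • Q x (frame c k x) +
      S.η x (R x (Y x)) (frame c k x) • R x (S.dualFrame c k x)) := by
    conv_lhs => rw [← h.add_apply x (Y x), ← h.left_left, ← h.right_right (Y x),
      eq_sum_coframe hx (Q x (Y x)), eq_sum_dualFrame (S := S) hx (R x (Y x))]
    simp only [map_sum, map_smul, Finset.sum_add_distrib]
  ext v
  conv_rhs => rw [_root_.add_apply, ContinuousLinearMap.smulRight_apply, h0]
  simp only [partialConnection, _root_.sum_apply, _root_.smul_apply, Finset.smul_sum,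
    ← Finset.sum_add_distrib]
  refine Finset.sum_congr rfl fun k _ ↦ ?_
  have h1 := mvfderiv_fun_mul hg (h.coframe_diffAt hx hY k)
  have h2 := mvfderiv_fun_mul hg (h.η_frame_diffAt hx hY k)
  simp only [Pi.smul_apply', map_smul, _root_.smul_apply, smul_eq_mul, h1, h2, _root_.add_apply,
    ContinuousLinearMap.smulRight_apply, ContinuousLinearMap.comp_apply]
  module

/-- The coefficients that are differentiated on the `Q`- and `R`-parts are paired by `η` as in
`η_eq_sum`, so metricity is the product rule. -/
theorem η_partialConnection (hx : x ∈ frameDomain E c) (hX : ∀ y, Q y (X y) = X y)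
    (hY : DiffAt Y x) (hZ : DiffAt Z x) :
    derivAlong X (fun y ↦ S.η y (Y y) (Z y)) x =
      S.η x (S.partialConnection Q R c Y x (X x)) (Z x)
        + S.η x (Y x) (S.partialConnection Q R c Z x (X x)) := by
  have h0 : ∀ᶠ y in 𝓝 x, S.η y (Y y) (Z y) =
      ∑ k, (coframe c k y (Q y (Y y)) * S.η y (R y (Z y)) (frame c k y)
        + coframe c k y (Q y (Z y)) * S.η y (R y (Y y)) (frame c k y)) := by
    filter_upwards [(isOpen_frameDomain c).mem_nhds hx] with y hy using h.η_eq_sum hy (Y y) (Z y)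
  have hc := fun k ↦ h.coframe_diffAt hx hY k
  have hc' := fun k ↦ h.coframe_diffAt hx hZ k
  have hf := fun k ↦ h.η_frame_diffAt hx hY k
  have hf' := fun k ↦ h.η_frame_diffAt hx hZ k
  rw [derivAlong_congr h0, derivAlong_sum fun k _ ↦
    ((hc k).fun_mul (hf' k)).fun_add ((hc' k).fun_mul (hf k))]
  rw [S.symm x (Y x)]
  simp only [partialConnection_apply, hX, map_sum, _root_.sum_apply, ← Finset.sum_add_distrib]
  refine Finset.sum_congr rfl fun k _ ↦ ?_
  rw [derivAlong_fun_add ((hc k).fun_mul (hf' k)) ((hc' k).fun_mul (hf k)),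
    derivAlong_mul (hc k) (hf' k), derivAlong_mul (hc' k) (hf k)]
  simp only [map_add, map_smul, _root_.add_apply, _root_.smul_apply, smul_eq_mul, h.η_left,
    h.η_right (S.dualFrame c k x), η_dualFrame hx]
  rw [S.symm x (frame c k x), S.symm x (frame c k x)]
  ring

theorem left_partialConnection (hY : ∀ y, Q y (Y y) = 0) :
    Q x (S.partialConnection Q R c Y x (X x)) = 0 := by
  rw [partialConnection_apply]
  simp [hY, h.left_right, derivAlong, mvfderiv_const]

theorem partialConnection_eq (hX : ∀ y, Q y (X y) = X y) (hY : ∀ y, Q y (Y y) = Y y) :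
    S.partialConnection Q R c Y x (X x) =
      Q x (∑ k, derivAlong X (fun y ↦ coframe c k y (Y y)) x • frame c k x) := by
  have hR : ∀ y, R y (Y y) = 0 := fun y ↦ by rw [← hY, h.right_left]
  rw [partialConnection_apply]
  simp [hY, hX, hR, derivAlong, mvfderiv_const]

theorem partialConnection_sub (hx : x ∈ frameDomain E c) (hX : ∀ y, Q y (X y) = X y)
    (hY : ∀ y, Q y (Y y) = Y y) (hX' : DiffAt X x) (hY' : DiffAt Y x) :
    S.partialConnection Q R c Y x (X x) - S.partialConnection Q R c X x (Y x) =
      Q x (lie X Y x) := by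
  rw [h.partialConnection_eq hX hY, h.partialConnection_eq hY hX, ← map_sub,
    ← Finset.sum_sub_distrib, lie_eq_sum_frame hx hX' hY']
  simp only [sub_smul]

end IsSplitting

theorem isSplitting (S : AlmostParaHermitian E P) : S.IsSplitting S.posProj S.negProj where
  smooth_left := fun x ↦ smoothEndAt_of_frame fun k ↦
    smoothAt_posProj (smoothAt_frame (mem_frameDomain x) k)
  smooth_right := fun x ↦ smoothEndAt_of_frame fun k ↦
    smoothAt_negProj (smoothAt_frame (mem_frameDomain x) k)
  add_apply _ v := posProj_add_negProj S v
  left_left _ v := posProj_of_mem (posProj_mem S v)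
  η_left _ _ _ := η_posProj_left

/-- The sum of the two partial connections along the subbundles of a splitting. -/
def localConnection (S : AlmostParaHermitian E P) (Q R : EndField E P) (c : P) (Y : VF E P) :
    EndField E P :=
  fun x ↦ S.partialConnection Q R c Y x + S.partialConnection R Q c Y x

theorem localConnection_comm (Y : VF E P) :
    S.localConnection Q R c Y x = S.localConnection R Q c Y x := add_comm _ _

namespace IsSplitting

variable (h : S.IsSplitting Q R)
include h

theorem localConnection_apply (hv : Q x (X x) = X x) :
    S.localConnection Q R c Y x (X x) = S.partialConnection Q R c Y x (X x) := by
  have hR : R x (X x) = 0 := by rw [← hv, h.right_left]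
  rw [localConnection, _root_.add_apply, add_eq_left, partialConnection_apply]
  simp [derivAlong, hR]

theorem isCovariantDerivativeOn_localConnection :
    IsCovariantDerivativeOn E (S.localConnection Q R c) (frameDomain E c) where
  add hY hZ hx := by
    simp only [localConnection, h.partialConnection_add hx hY hZ,
      h.swap.partialConnection_add hx hY hZ]
    abel
  leibniz {Y g x} hY hg hx := by
    have e : (mvfderiv 𝓘(ℝ, E) g x).smulRight (Y x) =
        ((mvfderiv 𝓘(ℝ, E) g x).comp (Q x)).smulRight (Y x) +
        ((mvfderiv 𝓘(ℝ, E) g x).comp (R x)).smulRight (Y x) := by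
      ext v
      simp only [_root_.add_apply, ContinuousLinearMap.smulRight_apply,
        ContinuousLinearMap.comp_apply, ← add_smul, ← map_add, h.add_apply]
    simp only [localConnection, h.partialConnection_smul hx hY hg,
      h.swap.partialConnection_smul hx hY hg, e, smul_add]
    abel

theorem smoothEndAt_localConnection (hx : x ∈ frameDomain E c) (hY : SmoothAt Y x) :
    SmoothEndAt (S.localConnection Q R c Y) x :=
  smoothEndAt_of_frame fun k ↦ SmoothAt.add
    (h.smoothAt_partialConnection hx (smoothAt_frame (mem_frameDomain x) k) hY)
    (h.swap.smoothAt_partialConnection hx (smoothAt_frame (mem_frameDomain x) k) hY)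

end IsSplitting

/-! ### Existence of adapted connections -/

/-- `D` is, at every point, an affine combination of the local connections of the splitting. -/
def IsPatching (S : AlmostParaHermitian E P) (Q R : EndField E P) (D : Connection E P) : Prop :=
  ∀ x : P, ∃ (s : Finset P) (w : P → ℝ), ∑ c ∈ s, w c = 1 ∧ (∀ c ∈ s, x ∈ frameDomain E c) ∧
    ∀ Y, D Y x = ∑ c ∈ s, w c • S.localConnection Q R c Y x

theorem IsPatching.swap {D : Connection E P} (h : S.IsPatching Q R D) : S.IsPatching R Q D := by
  intro x
  obtain ⟨s, w, h1, h2, h3⟩ := h x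
  exact ⟨s, w, h1, h2, fun Y ↦ by simp only [h3 Y, localConnection_comm (Q := Q)]⟩

/-- Weights of sum 1 reduce everything to the partial connections. On `L` the torsion is `Q[X, Y] -
[X, Y]`, which is zero by involutivity; the extra term of `torsion_right` vanishes because `D`
preserves the isotropic `L` along `L`. -/
theorem IsSplitting.isHalfAdapted (h : S.IsSplitting Q R) {L L' : Distribution E P}
    (hL : ∀ x v, v ∈ L x ↔ Q x v = v) (hL' : ∀ x v, v ∈ L' x ↔ Q x v = 0)
    (hI : Involutive L) {D : Connection E P} (hD : S.IsPatching Q R D) :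
    S.IsHalfAdapted L L' D := by
  have app : ∀ x : P, ∃ (s : Finset P) (w : P → ℝ), ∑ c ∈ s, w c = 1 ∧
      (∀ c ∈ s, x ∈ frameDomain E c) ∧ ∀ X Y : VF E P, X x ∈ L x →
        D Y x (X x) = ∑ c ∈ s, w c • S.partialConnection Q R c Y x (X x) := by
    intro x
    obtain ⟨s, w, h1, h2, h3⟩ := hD x
    refine ⟨s, w, h1, h2, fun X Y hX ↦ ?_⟩
    rw [h3, _root_.sum_apply]
    exact Finset.sum_congr rfl fun c _ ↦ by
      rw [_root_.smul_apply, h.localConnection_apply ((hL _ _).1 hX)]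
  have pr : ∀ X Y : VF E P, IsSection L X → IsSection L' Y → ∀ x, D Y x (X x) ∈ L' x := by
    intro X Y hX hY x
    obtain ⟨s, w, h1, h2, h3⟩ := app x
    rw [h3 X Y (hX.2 x)]
    exact Submodule.sum_mem _ fun c _ ↦ Submodule.smul_mem _ _
      ((hL' _ _).2 (h.left_partialConnection fun y ↦ (hL' _ _).1 (hY.2 y)))
  have pl : ∀ X Y : VF E P, IsSection L X → IsSection L Y → ∀ x, D Y x (X x) ∈ L x := by
    intro X Y hX hY x
    obtain ⟨s, w, h1, h2, h3⟩ := app x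
    rw [h3 X Y (hX.2 x)]
    refine Submodule.sum_mem _ fun c _ ↦ Submodule.smul_mem _ _ ((hL _ _).2 ?_)
    rw [h.partialConnection_eq (fun y ↦ (hL _ _).1 (hX.2 y)) (fun y ↦ (hL _ _).1 (hY.2 y)),
      h.left_left]
  have tor : ∀ X Y : VF E P, IsSection L X → IsSection L Y → ∀ x,
      D Y x (X x) - D X x (Y x) - lie X Y x = 0 := by
    intro X Y hX hY x
    obtain ⟨s, w, h1, h2, h3⟩ := app x
    rw [h3 X Y (hX.2 x), h3 Y X (hY.2 x), ← Finset.sum_sub_distrib, sub_eq_zero]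
    have : ∀ c ∈ s, w c • S.partialConnection Q R c Y x (X x) -
        w c • S.partialConnection Q R c X x (Y x) = w c • lie X Y x := fun c hc ↦ by
      rw [← smul_sub, h.partialConnection_sub (h2 c hc) (fun y ↦ (hL _ _).1 (hX.2 y))
        (fun y ↦ (hL _ _).1 (hY.2 y)) (hX.1.smoothAt x).diffAt (hY.1.smoothAt x).diffAt,
        (hL _ _).1 (hI X Y hX hY x)]
    rw [Finset.sum_congr rfl this, ← Finset.sum_smul, h1, one_smul]
  refine ⟨fun X Y Z hX hY hZ x ↦ ?_, pr, fun X Y Z hX hY _ x ↦ ?_, fun X Y Z hX hY hZ x ↦ ?_⟩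
  · obtain ⟨s, w, h1, h2, h3⟩ := app x
    rw [h3 X Y (hX.2 x), h3 X Z (hX.2 x), map_sum, map_sum, _root_.sum_apply,
      ← Finset.sum_add_distrib]
    have : ∀ c ∈ s, S.η x (w c • S.partialConnection Q R c Y x (X x)) (Z x) +
        S.η x (Y x) (w c • S.partialConnection Q R c Z x (X x)) =
        w c * derivAlong X (fun y ↦ S.η y (Y y) (Z y)) x := fun c hc ↦ by
      rw [h.η_partialConnection (h2 c hc) (fun y ↦ (hL _ _).1 (hX.2 y)) (hY.smoothAt x).diffAt
        (hZ.smoothAt x).diffAt]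
      simp only [map_smul, _root_.smul_apply, smul_eq_mul]
      ring
    rw [Finset.sum_congr rfl this, ← Finset.sum_mul, h1, one_mul]
  · rw [tor X Y hX hY, map_zero, _root_.zero_apply]
  · rw [tor X Y hX hY, map_zero, _root_.zero_apply, zero_add,
      ← (hL _ _).1 (pl Z X hZ hX x), ← (hL _ _).1 (hY.2 x), h.η_left, h.right_left, map_zero]

theorem IsSplitting.exists_isPatching [T2Space P] [SigmaCompactSpace P]
    (h : S.IsSplitting Q R) : ∃ D : Connection E P,
      CovariantDerivative.ContMDiffCovariantDerivative D ∞ ∧ S.IsPatching Q R D := by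
  obtain ⟨ρ, hρ⟩ := SmoothPartitionOfUnity.exists_isSubordinate 𝓘(ℝ, E) isClosed_univ
    (fun c : P ↦ frameDomain E c) isOpen_frameDomain
    fun x _ ↦ Set.mem_iUnion.2 ⟨x, mem_frameDomain x⟩
  let D : VF E P → EndField E P := fun Y x ↦ ∑ᶠ c, ρ c x • S.localConnection Q R c Y x
  have hD : ∀ x : P, ∃ (s : Finset P) (w : P → ℝ), ∑ c ∈ s, w c = 1 ∧
      (∀ c ∈ s, x ∈ frameDomain E c) ∧
      ∀ Y, D Y x = ∑ c ∈ s, w c • S.localConnection Q R c Y x := by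
    intro x
    have hf : (Function.support fun c ↦ ρ c x).Finite := ρ.locallyFinite.point_finite x
    refine ⟨hf.toFinset, fun c ↦ ρ c x, ?_, fun c hc ↦ ?_, fun Y ↦ ?_⟩
    · rw [← ρ.sum_eq_one (Set.mem_univ x), finsum_eq_sum _ hf]
    · exact hρ c (subset_closure (by simpa using hc))
    · refine finsum_eq_sum_of_support_subset _ fun c hc ↦ ?_
      simp only [Set.Finite.coe_toFinset]
      exact left_ne_zero_of_smul hc
  refine ⟨⟨D, ⟨fun {Y Z x} hY hZ _ ↦ ?_, fun {Y g x} hY hg _ ↦ ?_⟩⟩, ⟨⟨fun {Y} hY ↦ ?_⟩⟩, hD⟩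
  · obtain ⟨s, w, h1, h2, h3⟩ := hD x
    rw [h3, h3, h3, ← Finset.sum_add_distrib]
    exact Finset.sum_congr rfl fun c hc ↦ by
      rw [h.isCovariantDerivativeOn_localConnection.add hY hZ (h2 c hc), smul_add]
  · obtain ⟨s, w, h1, h2, h3⟩ := hD x
    have : ∀ c ∈ s, w c • S.localConnection Q R c (g • Y) x =
        g x • w c • S.localConnection Q R c Y x +
          w c • (mvfderiv 𝓘(ℝ, E) g x).smulRight (Y x) := fun c hc ↦ by
      rw [h.isCovariantDerivativeOn_localConnection.leibniz hY hg (h2 c hc), smul_add, smul_comm]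
    rw [h3, h3, Finset.sum_congr rfl this, Finset.sum_add_distrib, ← Finset.sum_smul, h1, one_smul,
      Finset.smul_sum]
  · have hY' : Smooth Y := by
      -- Smoothness of a connection takes fields with one more derivative, which costs nothing at
      -- `∞`.
      have h1 : ((∞ : WithTop ℕ∞) + 1) = ∞ := rfl
      rw [h1] at hY
      exact contMDiffOn_univ.1 hY
    refine ContMDiff.contMDiffOn (ContMDiff.finsum_section_of_locallyFinite ?_ fun c ↦ ?_)
    · exact ρ.locallyFinite.subset fun c x hx ↦ left_ne_zero_of_smul hx
    · exact ContMDiffOn.smul_section_of_tsupport (ρ c).contMDiff.contMDiffOn (isOpen_frameDomain c)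
        (hρ c) fun y hy ↦
          (h.smoothEndAt_localConnection hy (hY'.smoothAt y)).contMDiffWithinAt

theorem exists_isAdapted [T2Space P] [SigmaCompactSpace P] (S : AlmostParaHermitian E P)
    (hS : S.IsParaHermitian) : ∃ D : Connection E P, S.IsAdapted D := by
  obtain ⟨D, h, hD⟩ := S.isSplitting.exists_isPatching
  have hp : ∀ x v, v ∈ S.Tplus x ↔ S.posProj x v = v := fun x v ↦
    ⟨posProj_of_mem, fun h ↦ h ▸ posProj_mem S v⟩
  have hn : ∀ x v, v ∈ S.Tminus x ↔ S.negProj x v = v := fun x v ↦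
    ⟨negProj_of_mem, fun h ↦ h ▸ negProj_mem S v⟩
  exact ⟨D, h, S.isSplitting.isHalfAdapted hp
      (fun x v ↦ (hn x v).trans S.isSplitting.right_eq_self_iff) hS.1 hD,
    S.isSplitting.swap.isHalfAdapted hn
      (fun x v ↦ (hp x v).trans S.isSplitting.swap.right_eq_self_iff) hS.2 hD.swap⟩

end AlmostParaHermitian

/-! ### The Maurer–Cartan formula and compatibility -/

namespace AlmostParaHermitian

variable {E : Type*} [NormedAddCommGroup E] [NormedSpace ℝ E] [FiniteDimensional ℝ E]
  {P : Type*} [TopologicalSpace P] [ChartedSpace E P] [IsManifold 𝓘(ℝ, E) ∞ P]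
  {S : AlmostParaHermitian E P} {B : EndField E P} {D : Connection E P} {x : P}

theorem dBracket_add_left {X X' Y : VF E P} (hX : Smooth X) (hX' : Smooth X') :
    S.dBracket D (X + X') Y x = S.dBracket D X Y x + S.dBracket D X' Y x := by
  rw [← sub_eq_zero]
  refine S.nondegenerate x _ fun w ↦ ?_
  have h : D (X + X') x = D X x + D X' x :=
    D.isCovariantDerivativeOnUniv.add (hX.smoothAt x).diffAt (hX'.smoothAt x).diffAt
  simp only [dBracket, h, map_sub, map_add, _root_.sub_apply, _root_.add_apply, η_sharp,
    ContinuousLinearMap.comp_apply, Pi.add_apply]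
  ring

theorem dBracket_add_right {X Y Y' : VF E P} (hY : Smooth Y) (hY' : Smooth Y') :
    S.dBracket D X (Y + Y') x = S.dBracket D X Y x + S.dBracket D X Y' x := by
  rw [← sub_eq_zero]
  refine S.nondegenerate x _ fun w ↦ ?_
  have h : D (Y + Y') x = D Y x + D Y' x :=
    D.isCovariantDerivativeOnUniv.add (hY.smoothAt x).diffAt (hY'.smoothAt x).diffAt
  simp only [dBracket, h, map_sub, map_add, _root_.sub_apply, _root_.add_apply, η_sharp,
    ContinuousLinearMap.comp_apply, Pi.add_apply]
  ring

variable [T2Space P] [SigmaCompactSpace P]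

/-- Biadditivity gives eight terms, grouped 1 + 3 + 3 + 1 by degree in `B`. The extreme ones vanish;
the middle groups are `d₊b` and the Schouten term. -/
theorem IsAdapted.η_dBracket_graph (hS : S.IsParaHermitian) (hD : S.IsAdapted D)
    (hB : S.IsSkewMap B) {X Y Z : VF E P} (hX : IsSection S.Tplus X) (hY : IsSection S.Tplus Y)
    (hZ : IsSection S.Tplus Z) :
    S.η x (S.dBracket D (X + fun y ↦ B y (X y)) (Y + fun y ↦ B y (Y y)) x) (Z x + B x (Z x)) =
      S.maurerCartan B X Y Z x := by
  have hBX := hB.isSection hX.1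
  have hBY := hB.isSection hY.1
  have hBZ := hB.isSection hZ.1
  have h1 := hD.dBracket_Tplus hS hX hY hZ (x := x)
  have h2 := hD.dBracket_Tminus hS hBX hBY hBZ (x := x)
  have h3 := hD.dBracket_linear hB hX hY hZ (x := x)
  have h4 := hD.dBracket_quadratic hB hX hY hZ (x := x)
  rw [maurerCartan, schouten_eq hB hX.1 hY.1 hZ.1, dBracket_add_left hX.1 hBX.1,
    dBracket_add_right hY.1 hBY.1, dBracket_add_right hY.1 hBY.1]
  simp only [map_add, _root_.add_apply]
  linarith

theorem IsAdapted.η_dBracket_projPlus (hS : S.IsParaHermitian) (hD : S.IsAdapted D)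
    (hB : S.IsSkewMap B) {X Y Z : VF E P} (hX : Smooth X) (hY : Smooth Y) (hZ : Smooth Z) :
    S.η x (S.dBracket D (projPlus (S.bTransform B) X) (projPlus (S.bTransform B) Y) x)
      (projPlus (S.bTransform B) Z x) =
    S.maurerCartan B (projPlus S.K X) (projPlus S.K Y) (projPlus S.K Z) x := by
  rw [hB.projPlus_bTransform, hB.projPlus_bTransform, hB.projPlus_bTransform, projPlus_K,
    projPlus_K, projPlus_K]
  exact hD.η_dBracket_graph hS hB (isSection_posProj hX) (isSection_posProj hY)
    (isSection_posProj hZ)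

/-- Closure of the graph forces the three-form to vanish by isotropy, and maximal isotropy gives the
converse. The `-1`-eigenbundle is `T₋` and imposes no condition. -/
theorem IsAdapted.isCompatible_iff (hS : S.IsParaHermitian) (hD : S.IsAdapted D)
    (hB : S.IsSkewMap B) :
    S.IsCompatible D (S.bTransform B) ↔
      ∀ X Y Z : VF E P, IsSection S.Tplus X → IsSection S.Tplus Y → IsSection S.Tplus Z →
        ∀ x, S.maurerCartan B X Y Z x = 0 := by
  constructor
  · intro h X Y Z hX hY hZ x
    rw [← hD.η_dBracket_graph hS hB hX hY hZ]
    have hs : ∀ {X : VF E P}, IsSection S.Tplus X →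
        IsSection (eigenbundle (S.bTransform B) 1) (X + fun y ↦ B y (X y)) := fun {X} hX ↦
      ⟨fun y ↦ (hX.1.smoothAt y).add ((hB.isSection hX.1).1.smoothAt y),
        fun y ↦ hB.add_mem_eigenbundle (hX.2 y)⟩
    exact h.1.1 x _ (h.1.2 _ _ (hs hX) (hs hY) x) _ ((hs hZ).2 x)
  · intro h
    refine ⟨⟨fun x v hv w hw ↦ hB.η_eigenbundle hv hw, fun X Y hX hY x ↦ ?_⟩,
      ⟨fun x v hv w hw ↦ ?_, fun X Y hX hY x ↦ ?_⟩⟩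
    · refine hB.mem_eigenbundle_of_η fun w hw ↦ ?_
      obtain ⟨W, hW, rfl⟩ := exists_smooth_eq x w
      have h1 := hD.η_dBracket_projPlus hS hB hX.1 hY.1 hW (x := x)
      rw [projPlus_K, projPlus_K, projPlus_K, h _ _ _ (isSection_posProj hX.1)
        (isSection_posProj hY.1) (isSection_posProj hW)] at h1
      -- The projection fixes the graph, so claim 1 applies to arbitrary sections of it.
      have e : ∀ {X : VF E P}, (∀ y, X y ∈ eigenbundle (S.bTransform B) 1 y) →
          projPlus (S.bTransform B) X = X := fun {X} hX ↦ by
        rw [hB.projPlus_bTransform]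
        ext y
        exact hB.eq_of_mem_eigenbundle (hX y)
      have e' : projPlus (S.bTransform B) W x = W x := by
        rw [hB.projPlus_bTransform]
        exact hB.eq_of_mem_eigenbundle hw
      rwa [e hX.2, e hY.2, e'] at h1
    · exact η_Tminus (hB.mem_eigenbundle_neg_one.1 hv) (hB.mem_eigenbundle_neg_one.1 hw)
    · have hX' : IsSection S.Tminus X := ⟨hX.1, fun y ↦ hB.mem_eigenbundle_neg_one.1 (hX.2 y)⟩
      have hY' : IsSection S.Tminus Y := ⟨hY.1, fun y ↦ hB.mem_eigenbundle_neg_one.1 (hY.2 y)⟩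
      refine hB.mem_eigenbundle_neg_one.2 (mem_Tminus_of_η fun w hw ↦ ?_)
      obtain ⟨W, hW, rfl⟩ := exists_isSection_Tminus hw
      exact hD.dBracket_Tminus hS hX' hY' hW

end AlmostParaHermitian

end ParaHermitian

end

open ParaHermitian in
theorem mainTheorem4
    {E : Type*} [NormedAddCommGroup E] [NormedSpace ℝ E] [FiniteDimensional ℝ E]
    {P : Type*} [TopologicalSpace P] [T2Space P] [SigmaCompactSpace P]
    [ChartedSpace E P] [IsManifold 𝓘(ℝ, E) ∞ P]
    (S : AlmostParaHermitian E P) (hS : S.IsParaHermitian)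
    (B : EndField E P) (hB : S.IsSkewMap B) :
    (∃ D : Connection E P, S.IsAdapted D) ∧
    ∀ D : Connection E P, S.IsAdapted D →
      (∀ X Y Z : VF E P, Smooth X → Smooth Y → Smooth Z → ∀ x,
        S.η x
          (S.dBracket D
            (AlmostParaHermitian.projPlus (S.bTransform B) X)
            (AlmostParaHermitian.projPlus (S.bTransform B) Y) x)
          (AlmostParaHermitian.projPlus (S.bTransform B) Z x) =
        S.maurerCartan B
          (AlmostParaHermitian.projPlus S.K X)
          (AlmostParaHermitian.projPlus S.K Y)
          (AlmostParaHermitian.projPlus S.K Z) x) ∧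
      (S.IsCompatible D (S.bTransform B) ↔
        ∀ X Y Z : VF E P, IsSection S.Tplus X → IsSection S.Tplus Y → IsSection S.Tplus Z →
          ∀ x, S.maurerCartan B X Y Z x = 0) :=
  ⟨S.exists_isAdapted hS, fun _ hD ↦ ⟨fun _ _ _ hX hY hZ _ ↦
    hD.η_dBracket_projPlus hS hB hX hY hZ, hD.isCompatible_iff hS hB⟩⟩
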